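/- Let $d\ge 2$, let $\mathcal P$ be a probability distribution, and let $f(x)=\mathbb E_{\xi\sim\mathcal P}[f_\xi(x)]$ on $\mathbb R^d$, where every $f_\xi$ is twice differentiable and $f$ is twice differentiable with $L$-Lipschitz Hessian: $\|\nabla^2 f(x)-\nabla^2 f(y)\|\le L\|x-y\|$ for all $x,y$ (Euclidean norm for vectors, spectral norm for matrices). Assume that for constants $\sigma_h,\delta_h\ge 0$ and all $x\in\mathbb R^d$ $$\mathbb E\,\nabla^2 f_\xi(x)=\nabla^2 f(x),\qquad \mathbb E\|\nabla^2 f_\xi(x)-\nabla^2 f(x)\|^2\le\sigma_h^2,\qquad \|\nabla^2 f_\xi(x)-\nabla^2 f(x)\|\le\delta_h\ \text{ a.s.}$$ Let $(x_t)_{t\ge0}$ be the iterates of a stochastic method started at a fixed point $x_0$ (for example the cubic Newton method with momentum): at each step $t\ge 1$ the iterate $x_t$ is determined by the past, and the sample $\xi_t\sim\mathcal P$ is independent of the past. Let $\beta\in(0,1]$ and let the Hessian estimates be given by heavy-ball momentum, $$H_t=(1-\beta)H_{t-1}+\beta\,\nabla^2 f_{\xi_t}(x_t)\quad(t\ge1),\qquad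 H_0=\frac1b\sum_{j=1}^{b}\nabla^2 f_{\xi_{0,j}}(x_0),$$ where $\xi_{0,1},\dots,\xi_{0,b}\sim\mathcal P$ are independent samples belonging to the past of step $1$, $b\ge1$ (a single sample if $b=1$). Put $\Sigma_t=H_t-\nabla^2 f(x_t)$ and $r_t=\|x_{t+1}-x_t\|$, and let $\sigma_{h,0}$ be an initial noise level in the sense that $\mathbb E\|\Sigma_0\|^3\le\sigma_{h,0}^3$. Then for every $T\ge1$ $$\frac1T\sum_{t=0}^{T-1}\mathbb E\|\Sigma_t\|^3\;\le\;\frac{10\,\sigma_{h,0}^3}{\beta T}+\beta^{3/2}\,\tilde\sigma_h^3(\beta)+\frac{9(1-\beta)L^3}{\beta^3}\cdot\frac1T\sum_{t=0}^{T-1}\mathbb E\,r_t^3 ,$$ where $$\tilde\sigma_h^3(\beta)=8(er)^{3/2}\sigma_h^3+16(er)^3\beta^{3/2}\delta_h^3,\qquad r=2\log d .$$ Expectations of nonnegative quantities are taken in $[0,\infty]$, with $0\cdot\infty=0$. -/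

import Mathlib

open MeasureTheory ProbabilityTheory
open scoped ENNReal

/-- The Hessian of `g` at `x`: the derivative of the gradient, as a linear operator.
Its norm is the Euclidean operator norm, i.e. the spectral norm. -/
noncomputable def hess {d : ℕ} (g : EuclideanSpace ℝ (Fin d) → ℝ)
    (x : EuclideanSpace ℝ (Fin d)) :
    EuclideanSpace ℝ (Fin d) →L[ℝ] EuclideanSpace ℝ (Fin d) :=
  fderiv ℝ (gradient g) x

/-- `g` is twice differentiable on the whole space. -/
def TwiceDifferentiable {d : ℕ} (g : EuclideanSpace ℝ (Fin d) → ℝ) : Prop :=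
  Differentiable ℝ g ∧ Differentiable ℝ (gradient g)

/-- The objective `f(x) = E_{s ∼ D} f_s(x)`. -/
noncomputable def objective {d : ℕ} {S : Type*} [MeasurableSpace S] (D : Measure S)
    (F : S → EuclideanSpace ℝ (Fin d) → ℝ) (x : EuclideanSpace ℝ (Fin d)) : ℝ :=
  ∫ s, F s x ∂D

/-- The stochastic problem is well posed: the samples `f_s` are twice differentiable, the
expectation that defines `f` exists, and `f` is twice differentiable with an `L`-Lipschitz
Hessian. -/
structure IsStochasticProblem {d : ℕ} {S : Type*} [MeasurableSpace S] (D : Measure S)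
    (F : S → EuclideanSpace ℝ (Fin d) → ℝ) (L : ℝ) : Prop where
  measurable : ∀ x, Measurable fun s => F s x
  integrable : ∀ x, Integrable (fun s => F s x) D
  sample_twiceDifferentiable : ∀ s, TwiceDifferentiable (F s)
  twiceDifferentiable : TwiceDifferentiable (objective D F)
  hess_lipschitz : ∀ x y,
    ‖hess (objective D F) x - hess (objective D F) y‖ ≤ L * ‖x - y‖

/-- The Hessian noise assumption: at every point the sampled Hessian is unbiased, has variance
at most `σ ^ 2`, and is almost surely within `δ` of the true Hessian. -/
structure HessianNoise {d : ℕ} {S : Type*} [MeasurableSpace S] (D : Measure S)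
    (F : S → EuclideanSpace ℝ (Fin d) → ℝ) (σ δ : ℝ) : Prop where
  mean : ∀ x, ∫ s, hess (F s) x ∂D = hess (objective D F) x
  variance : ∀ x, ∫ s, ‖hess (F s) x - hess (objective D F) x‖ ^ 2 ∂D ≤ σ ^ 2
  bound : ∀ x, ∀ᵐ s ∂D, ‖hess (F s) x - hess (objective D F) x‖ ≤ δ

/-- The average of the Hessians at `x` over the batch `z`. -/
noncomputable def batchHess {d b : ℕ} {S : Type*} (F : S → EuclideanSpace ℝ (Fin d) → ℝ)
    (z : Fin b → S) (x : EuclideanSpace ℝ (Fin d)) :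
    EuclideanSpace ℝ (Fin d) →L[ℝ] EuclideanSpace ℝ (Fin d) :=
  (b : ℝ)⁻¹ • ∑ j, hess (F (z j)) x

/-- Heavy-ball Hessian momentum along the points `x 0, x 1, …`:
`H_0` is computed from the initial batch `z` (a single sample when `b = 1`) and
`H_t = (1 - β) H_{t-1} + β ∇² f_{s_t}(x_t)` for `t ≥ 1`. -/
noncomputable def hessMomentum {d b : ℕ} {S : Type*} (F : S → EuclideanSpace ℝ (Fin d) → ℝ)
    (β : ℝ) (x : ℕ → EuclideanSpace ℝ (Fin d)) (z : Fin b → S) (s : ℕ → S) :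
    ℕ → EuclideanSpace ℝ (Fin d) →L[ℝ] EuclideanSpace ℝ (Fin d)
  | 0 => batchHess F z (x 0)
  | t + 1 => (1 - β) • hessMomentum F β x z s t + β • hess (F (s (t + 1))) (x (t + 1))

/-- The iterates and samples of a stochastic method. `ℱ t` is the past at the moment when the
sample(s) of step `t` are drawn: it determines `x t`, but not those samples. The samples have
law `D`; the batch `ζ` of step `0` consists of independent samples, and for `t ≥ 1` the sample
`ξ t` is independent of the past. No rule that produces `x (t + 1)` from the past is
prescribed: it may be a cubic Newton step with any gradient estimate, or any other step. -/
structure IsSampledRun {Ω S : Type*} [mΩ : MeasurableSpace Ω] [MeasurableSpace S] {d b : ℕ}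
    (P : Measure Ω) (D : Measure S) (ℱ : Filtration ℕ mΩ) (x₀ : EuclideanSpace ℝ (Fin d))
    (x : ℕ → Ω → EuclideanSpace ℝ (Fin d)) (ζ : Fin b → Ω → S) (ξ : ℕ → Ω → S) : Prop where
  init : ∀ ω, x 0 ω = x₀
  iterate_measurable : ∀ t, Measurable[ℱ t] (x t)
  batch_measurable : ∀ j, Measurable[ℱ 1] (ζ j)
  batch_law : ∀ j, P.map (ζ j) = D
  batch_indep : iIndepFun ζ P
  sample_measurable : ∀ t, 1 ≤ t → Measurable[ℱ (t + 1)] (ξ t)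
  sample_law : ∀ t, 1 ≤ t → P.map (ξ t) = D
  sample_indep : ∀ t, 1 ≤ t → Indep (MeasurableSpace.comap (ξ t) inferInstance) (ℱ t) P

/-- The variance constant `8 (e r)^{3/2} σ³ + 16 (e r)³ β^{3/2} δ³` with `r = 2 log d`. -/
noncomputable def hessVarianceConst (d : ℕ) (β σ δ : ℝ) : ℝ :=
  8 * (Real.exp 1 * (2 * Real.log d)) ^ (3 / 2 : ℝ) * σ ^ 3
    + 16 * (Real.exp 1 * (2 * Real.log d)) ^ 3 * β ^ (3 / 2 : ℝ) * δ ^ 3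

/-! Unrolling the recursion splits the error `Σ_t` into three parts: the initial error, damped by
`(1 - β)^t`; a drift, the discounted sum of the changes of the true Hessian, times `1 - β`; and a
discounted sum of sampling noises (`hessMomentum_sub_eq`). Jensen's inequality with weights
depending on `β` separates their cubes. The initial part sums as a geometric series. The drift obeys
a contraction with factor `1 - β`, driven by `L * r_t`, which telescopes to the factor `L³ / β³`.

The substance is the third moment of the noise sum `U_t` in spectral norm, with only a logarithmic
loss in `d`. The potential is `tr cosh (θ U_t)`. For symmetric `A`, `X` the function `φ s = tr cosh
(A + s X)` satisfies `φ'' ≤ ‖X‖² φ`: in an eigenbasis of `A` this is a rearrangement inequality for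
powers of eigenvalues (`opTrace_pow_mul_pow_mul_le`). A scalar comparison then gives `φ 1 ≤ φ 0 + φ'
0 + (3/4) ‖X‖² φ 0` when `‖X‖ ≤ 1` (`traceCosh_add_le`), so no matrix exponential inequality is
needed. With `X` a multiple of a fresh sample's noise, the linear term has mean zero, and one step
multiplies the expected potential by at most `exp ((3/4) θ² β² σ²)`. By induction it stays below `d
* exp ((3/4) θ² v)`, where `v` dominates the variance recursion. Since `cosh (θ ‖U_t‖)` is bounded
by the trace, a suitable `θ` yields a third moment of order `(log d / θ)³`.

All trace estimates are made for Taylor truncations of `cosh`, which involve only powers of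
operators; the full series returns at the end through termwise integration. -/

/-! ### Traces of powers of symmetric operators and the truncated trace of cosh -/

section TraceFunctions

variable {E : Type*} [NormedAddCommGroup E] [InnerProductSpace ℝ E] [FiniteDimensional ℝ E]

/-- The trace as a continuous linear functional on operators of a finite-dimensional space. -/
noncomputable def opTrace (E : Type*) [NormedAddCommGroup E] [InnerProductSpace ℝ E]
    [FiniteDimensional ℝ E] : (E →L[ℝ] E) →L[ℝ] ℝ :=
  LinearMap.toContinuousLinearMap
    ((LinearMap.trace ℝ E).comp (ContinuousLinearMap.coeLM ℝ : (E →L[ℝ] E) →ₗ[ℝ] E →ₗ[ℝ] E))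

theorem opTrace_apply (A : E →L[ℝ] E) : opTrace E A = LinearMap.trace ℝ E (A : E →ₗ[ℝ] E) := rfl

theorem opTrace_mul_comm (A B : E →L[ℝ] E) : opTrace E (A * B) = opTrace E (B * A) := by
  simp only [opTrace_apply]
  exact LinearMap.trace_mul_comm ℝ (A : E →ₗ[ℝ] E) (B : E →ₗ[ℝ] E)

theorem opTrace_eq_sum_inner {ι : Type*} [Fintype ι] (b : OrthonormalBasis ι ℝ E)
    (A : E →L[ℝ] E) : opTrace E A = ∑ i, inner ℝ (b i) (A (b i)) := by
  rw [opTrace_apply, LinearMap.trace_eq_sum_inner _ b]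
  rfl

theorem opTrace_one : opTrace E 1 = Module.finrank ℝ E := by
  rw [opTrace_apply]
  exact LinearMap.trace_one ℝ E

theorem IsSymmetric.exists_eigenbasis {A : E →L[ℝ] E} (hA : (A : E →ₗ[ℝ] E).IsSymmetric) :
    ∃ (b : OrthonormalBasis (Fin (Module.finrank ℝ E)) ℝ E) (lam : Fin (Module.finrank ℝ E) → ℝ),
      ∀ (n : ℕ) i, (A ^ n) (b i) = lam i ^ n • b i := by
  refine ⟨hA.eigenvectorBasis rfl, hA.eigenvalues rfl, fun n i => ?_⟩
  induction n with
  | zero => simp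
  | succ n ih =>
    have h : A (hA.eigenvectorBasis rfl i) = hA.eigenvalues rfl i • hA.eigenvectorBasis rfl i :=
      hA.apply_eigenvectorBasis rfl i
    rw [pow_succ, mul_apply_eq_comp, h, map_smul, ih, smul_smul, pow_succ, mul_comm]

theorem opTrace_pow_eq_sum {A : E →L[ℝ] E}
    {b : OrthonormalBasis (Fin (Module.finrank ℝ E)) ℝ E} {lam : Fin (Module.finrank ℝ E) → ℝ}
    (h : ∀ (n : ℕ) i, (A ^ n) (b i) = lam i ^ n • b i) (n : ℕ) :
    opTrace E (A ^ n) = ∑ i, lam i ^ n := by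
  rw [opTrace_eq_sum_inner b]
  refine Finset.sum_congr rfl fun i _ => ?_
  rw [h, inner_smul_right, real_inner_self_eq_norm_sq, b.norm_eq_one]
  simp

theorem opTrace_pow_even_nonneg {A : E →L[ℝ] E} (hA : (A : E →ₗ[ℝ] E).IsSymmetric) (m : ℕ) :
    0 ≤ opTrace E (A ^ (2 * m)) := by
  obtain ⟨b, lam, h⟩ := IsSymmetric.exists_eigenbasis hA
  rw [opTrace_pow_eq_sum h]
  exact Finset.sum_nonneg fun i _ => by rw [pow_mul]; positivity

theorem norm_pow_even_le_opTrace [Nontrivial E] {A : E →L[ℝ] E}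
    (hA : (A : E →ₗ[ℝ] E).IsSymmetric) (m : ℕ) : ‖A‖ ^ (2 * m) ≤ opTrace E (A ^ (2 * m)) := by
  obtain ⟨b, lam, h⟩ := IsSymmetric.exists_eigenbasis hA
  rw [opTrace_pow_eq_sum h]
  have hne : Nonempty (Fin (Module.finrank ℝ E)) := ⟨⟨0, Module.finrank_pos⟩⟩
  obtain ⟨i, hi⟩ := Finite.exists_max fun i => |lam i|
  have hnorm : ‖A‖ ≤ |lam i| := by
    refine ContinuousLinearMap.opNorm_le_bound _ (abs_nonneg _) fun x => ?_
    refine abs_le_of_sq_le_sq' ?_ (by positivity) |>.2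
    rw [← b.sum_sq_norm_inner_right (A x), mul_pow, ← b.sum_sq_norm_inner_right x, Finset.mul_sum]
    refine Finset.sum_le_sum fun k _ => ?_
    have h1 : inner ℝ (b k) (A x) = lam k * inner ℝ (b k) x := by
      have h2 : inner ℝ (A (b k)) x = inner ℝ (b k) (A x) := hA (b k) x
      have h3 := h 1 k
      rw [pow_one, pow_one] at h3
      rw [← h2, h3, real_inner_smul_left]
    rw [h1, norm_mul, mul_pow, Real.norm_eq_abs]
    exact mul_le_mul_of_nonneg_right (pow_le_pow_left₀ (abs_nonneg _) (hi k) 2) (sq_nonneg _)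
  calc ‖A‖ ^ (2 * m) ≤ |lam i| ^ (2 * m) := by gcongr
    _ = lam i ^ (2 * m) := by rw [pow_mul, sq_abs, ← pow_mul]
    _ ≤ _ := Finset.single_le_sum (f := fun i => lam i ^ (2 * m))
        (fun i _ => by rw [pow_mul]; positivity) (Finset.mem_univ i)

/-- With absolute values, the difference of the two sides is `(|x|^j - |y|^j) * (|x|^k - |y|^k)`,
whose factors have the same sign. Evenness lets the absolute values be dropped on the right. -/
theorem pow_mul_pow_add_le (x y : ℝ) {j k : ℕ} (h : Even (j + k)) :
    x ^ j * y ^ k + y ^ j * x ^ k ≤ x ^ (j + k) + y ^ (j + k) := by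
  have hx := abs_nonneg x
  have hy := abs_nonneg y
  have h1 : x ^ j * y ^ k ≤ |x| ^ j * |y| ^ k := by
    rw [← abs_pow, ← abs_pow, ← abs_mul]; exact le_abs_self _
  have h2 : y ^ j * x ^ k ≤ |y| ^ j * |x| ^ k := by
    rw [← abs_pow, ← abs_pow, ← abs_mul]; exact le_abs_self _
  rw [← h.pow_abs x, ← h.pow_abs y, pow_add, pow_add]
  have h3 : 0 ≤ (|x| ^ j - |y| ^ j) * (|x| ^ k - |y| ^ k) := by
    rcases le_total |x| |y| with hxy | hxy
    · exact mul_nonneg_of_nonpos_of_nonpos (sub_nonpos.2 (pow_le_pow_left₀ hx hxy j))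
        (sub_nonpos.2 (pow_le_pow_left₀ hx hxy k))
    · exact mul_nonneg (sub_nonneg.2 (pow_le_pow_left₀ hy hxy j))
        (sub_nonneg.2 (pow_le_pow_left₀ hy hxy k))
  linarith

/-- In an eigenbasis of `A` the trace is the sum of `X_pq² λ_p^j λ_q^k`. The weights `X_pq²` are
symmetric, so the sum may be symmetrized in `p, q` and `pow_mul_pow_add_le` moves the whole exponent
onto one eigenvalue. The remaining sum over `q` is `‖X b_p‖²`. -/
theorem opTrace_pow_mul_pow_mul_le {A X : E →L[ℝ] E} (hA : (A : E →ₗ[ℝ] E).IsSymmetric)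
    (hX : (X : E →ₗ[ℝ] E).IsSymmetric) {j k : ℕ} (hjk : Even (j + k)) :
    opTrace E (A ^ j * X * A ^ k * X) ≤ ‖X‖ ^ 2 * opTrace E (A ^ (j + k)) := by
  obtain ⟨b, lam, h⟩ := IsSymmetric.exists_eigenbasis hA
  have hsym : ∀ (n : ℕ) v i, inner ℝ (b i) ((A ^ n) v) = lam i ^ n * inner ℝ (b i) v := by
    intro n v i
    have h2 : inner ℝ ((A ^ n) (b i)) v = inner ℝ (b i) ((A ^ n) v) := by
      simpa [Module.End.pow_apply] using (hA.pow n) (b i) v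
    rw [← h2, h, real_inner_smul_left]
  have hXs : ∀ u v, inner ℝ u (X v) = inner ℝ (X u) v := fun u v => (hX u v).symm
  have hexp : opTrace E (A ^ j * X * A ^ k * X)
      = ∑ p, ∑ q, inner ℝ (b q) (X (b p)) ^ 2 * (lam p ^ j * lam q ^ k) := by
    rw [opTrace_eq_sum_inner b]
    refine Finset.sum_congr rfl fun p _ => ?_
    simp only [mul_apply_eq_comp]
    rw [hsym, hXs, ← b.sum_inner_mul_inner, Finset.mul_sum]
    refine Finset.sum_congr rfl fun q _ => ?_
    rw [hsym, real_inner_comm]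
    ring
  have hcomm : ∀ p q, inner ℝ (b q) (X (b p)) ^ 2 = inner ℝ (b p) (X (b q)) ^ 2 := by
    intro p q
    rw [hXs, real_inner_comm]
  have hsw : ∀ j k : ℕ, ∑ p, ∑ q, inner ℝ (b q) (X (b p)) ^ 2 * (lam p ^ j * lam q ^ k)
      = ∑ p, ∑ q, inner ℝ (b q) (X (b p)) ^ 2 * (lam q ^ j * lam p ^ k) := by
    intro j k
    rw [Finset.sum_comm]
    refine Finset.sum_congr rfl fun p _ => Finset.sum_congr rfl fun q _ => ?_
    rw [hcomm]
  have hkey : ∑ p, ∑ q, inner ℝ (b q) (X (b p)) ^ 2 * (lam p ^ j * lam q ^ k)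
      ≤ ∑ p, ∑ q, inner ℝ (b q) (X (b p)) ^ 2 * (lam p ^ (j + k) * lam q ^ 0) := by
    have h2 : ∑ p, ∑ q, inner ℝ (b q) (X (b p)) ^ 2 * (lam p ^ j * lam q ^ k)
        + ∑ p, ∑ q, inner ℝ (b q) (X (b p)) ^ 2 * (lam q ^ j * lam p ^ k)
        ≤ ∑ p, ∑ q, inner ℝ (b q) (X (b p)) ^ 2 * (lam p ^ (j + k) * lam q ^ 0)
        + ∑ p, ∑ q, inner ℝ (b q) (X (b p)) ^ 2 * (lam q ^ (j + k) * lam p ^ 0) := by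
      simp only [← Finset.sum_add_distrib]
      refine Finset.sum_le_sum fun p _ => Finset.sum_le_sum fun q _ => ?_
      have := mul_le_mul_of_nonneg_left (pow_mul_pow_add_le (lam p) (lam q) hjk)
        (sq_nonneg (inner ℝ (b q) (X (b p))))
      simp only [pow_zero, mul_one]
      linarith
    have e1 := hsw j k
    have e2 := hsw (j + k) 0
    linarith
  rw [hexp, opTrace_pow_eq_sum h, Finset.mul_sum]
  refine hkey.trans (Finset.sum_le_sum fun p _ => ?_)
  simp only [pow_zero, mul_one]
  rw [← Finset.sum_mul]
  have h3 : ∑ q, inner ℝ (b q) (X (b p)) ^ 2 = ‖X (b p)‖ ^ 2 := by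
    rw [← b.sum_sq_norm_inner_right]
    simp
  have h4 : ‖X (b p)‖ ≤ ‖X‖ := by simpa using X.le_opNorm (b p)
  rw [h3]
  have := hjk.pow_nonneg (lam p)
  gcongr

/-- Partial sums of the trace of `cosh A`. -/
noncomputable def traceCosh (N : ℕ) (A : E →L[ℝ] E) : ℝ :=
  ∑ m ∈ Finset.range N, opTrace E (A ^ (2 * m)) / (2 * m).factorial

/-- The derivative of `traceCosh N` at `A`. -/
noncomputable def traceSinh (N : ℕ) (A : E →L[ℝ] E) : (E →L[ℝ] E) →L[ℝ] ℝ :=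
  ∑ m ∈ Finset.range N, ((2 * m : ℕ) / ((2 * m).factorial : ℝ)) •
    (opTrace E).comp (ContinuousLinearMap.mul ℝ (E →L[ℝ] E) (A ^ (2 * m - 1)))

theorem traceCosh_nonneg {A : E →L[ℝ] E} (hA : (A : E →ₗ[ℝ] E).IsSymmetric) (N : ℕ) :
    0 ≤ traceCosh N A :=
  Finset.sum_nonneg fun m _ => div_nonneg (opTrace_pow_even_nonneg hA m) (by positivity)

theorem hasDerivAt_opTrace_pow (A X : E →L[ℝ] E) (n : ℕ) (s : ℝ) :
    HasDerivAt (fun s : ℝ => opTrace E ((A + s • X) ^ n))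
      (n * opTrace E ((A + s • X) ^ (n - 1) * X)) s := by
  have h0 : HasDerivAt (fun s : ℝ => A + s • X) X s := by
    simpa using ((hasDerivAt_id s).smul_const X).const_add A
  have h1 := (opTrace E).hasFDerivAt.comp_hasDerivAt s (h0.fun_pow' n)
  refine h1.congr_deriv ?_
  rw [map_sum, Finset.sum_congr rfl (g := fun _ => opTrace E ((A + s • X) ^ (n - 1) * X)),
    Finset.sum_const, Finset.card_range, nsmul_eq_mul]
  intro i hi
  have hi' := Finset.mem_range.1 hi
  rw [opTrace_mul_comm, ← mul_assoc, ← pow_add]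
  congr 3
  simp only [Nat.pred_eq_sub_one]
  omega

theorem hasDerivAt_opTrace_pow_mul (A X : E →L[ℝ] E) (n : ℕ) (s : ℝ) :
    HasDerivAt (fun s : ℝ => opTrace E ((A + s • X) ^ n * X))
      (∑ i ∈ Finset.range n, opTrace E ((A + s • X) ^ (n - 1 - i) * X * (A + s • X) ^ i * X)) s := by
  have h0 : HasDerivAt (fun s : ℝ => A + s • X) X s := by
    simpa using ((hasDerivAt_id s).smul_const X).const_add A
  have h1 := (opTrace E).hasFDerivAt.comp_hasDerivAt s ((h0.fun_pow' n).mul_const X)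
  refine h1.congr_deriv ?_
  rw [Finset.sum_mul, map_sum]
  rfl

theorem hasDerivAt_traceCosh (N : ℕ) (A X : E →L[ℝ] E) (s : ℝ) :
    HasDerivAt (fun s : ℝ => traceCosh N (A + s • X)) (traceSinh N (A + s • X) X) s := by
  have h : ∀ m ∈ Finset.range N, HasDerivAt
      (fun s : ℝ => opTrace E ((A + s • X) ^ (2 * m)) / (2 * m).factorial)
      ((2 * m : ℕ) * opTrace E ((A + s • X) ^ (2 * m - 1) * X) / (2 * m).factorial) s :=
    fun m _ => (hasDerivAt_opTrace_pow A X (2 * m) s).div_const _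
  refine (HasDerivAt.fun_sum h).congr_deriv ?_
  simp only [traceSinh, sum_apply]
  refine Finset.sum_congr rfl fun m _ => ?_
  simp
  ring

/-- This is `φ'' ≤ ‖X‖² φ`. Differentiating the power `2m + 2` twice gives `(2m + 2)(2m + 1)`
traces, each at most `‖X‖²` times the trace of the power `2m`, and the factorials match those of
cosh. -/
theorem exists_hasDerivAt_traceSinh (N : ℕ) {A X : E →L[ℝ] E}
    (hA : (A : E →ₗ[ℝ] E).IsSymmetric) (hX : (X : E →ₗ[ℝ] E).IsSymmetric) (s : ℝ) :
    ∃ f'' : ℝ, HasDerivAt (fun s : ℝ => traceSinh N (A + s • X) X) f'' s ∧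
      f'' ≤ ‖X‖ ^ 2 * traceCosh N (A + s • X) := by
  have hS : ((A + s • X : E →L[ℝ] E) : E →ₗ[ℝ] E).IsSymmetric := by
    simpa using hA.add (hX.smul (c := s) (by simp))
  have h : ∀ m ∈ Finset.range N, HasDerivAt
      (fun s : ℝ => ((2 * m : ℕ) / ((2 * m).factorial : ℝ))
        * opTrace E ((A + s • X) ^ (2 * m - 1) * X))
      (((2 * m : ℕ) / ((2 * m).factorial : ℝ)) * ∑ i ∈ Finset.range (2 * m - 1),
        opTrace E ((A + s • X) ^ (2 * m - 1 - 1 - i) * X * (A + s • X) ^ i * X)) s :=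
    fun m _ => (hasDerivAt_opTrace_pow_mul A X (2 * m - 1) s).const_mul _
  refine ⟨_, (HasDerivAt.fun_sum h).congr_of_eventuallyEq (Filter.Eventually.of_forall fun s => ?_),
    ?_⟩
  · simp [traceSinh]
  rcases N with _ | N
  · simp [traceCosh]
  -- The index shifts by one: term `m + 1` on the left is compared with term `m` on the right. The
  -- left term of index `0` vanishes and is set against the unmatched top term, which is
  -- nonnegative.
  rw [Finset.sum_range_succ', traceCosh, Finset.sum_range_succ, mul_add]
  refine add_le_add ((Finset.sum_le_sum fun m _ => ?_).trans_eq (Finset.mul_sum _ _ _).symm) ?_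
  · have h1 : ∀ i ∈ Finset.range (2 * (m + 1) - 1),
        opTrace E ((A + s • X) ^ (2 * (m + 1) - 1 - 1 - i) * X * (A + s • X) ^ i * X)
          ≤ ‖X‖ ^ 2 * opTrace E ((A + s • X) ^ (2 * m)) := by
      intro i hi
      have hi' := Finset.mem_range.1 hi
      have he : 2 * (m + 1) - 1 - 1 - i + i = 2 * m := by omega
      have := opTrace_pow_mul_pow_mul_le hS hX (j := 2 * (m + 1) - 1 - 1 - i) (k := i)
        (he ▸ even_two_mul m)
      rwa [he] at this
    have h2 := Finset.sum_le_sum h1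
    rw [Finset.sum_const, Finset.card_range, nsmul_eq_mul] at h2
    have h3 : ((2 * (m + 1)).factorial : ℝ) = (2 * m + 2) * ((2 * m + 1) * (2 * m).factorial) := by
      rw [show 2 * (m + 1) = 2 * m + 1 + 1 by ring, Nat.factorial_succ, Nat.factorial_succ]
      push_cast
      ring
    have h4 : ((2 * (m + 1) - 1 : ℕ) : ℝ) = 2 * m + 1 := by
      rw [show 2 * (m + 1) - 1 = 2 * m + 1 by omega]
      push_cast
      ring
    refine (mul_le_mul_of_nonneg_left h2 (by positivity)).trans (le_of_eq ?_)
    rw [h3, h4]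
    have : ((2 * m).factorial : ℝ) ≠ 0 := by positivity
    push_cast
    field_simp
  · simp only [mul_zero, Nat.cast_zero, zero_div, zero_mul]
    exact mul_nonneg (sq_nonneg _) (div_nonneg (opTrace_pow_even_nonneg hS N) (by positivity))

end TraceFunctions

/-! ### Scalar comparison for the inequality f'' ≤ c² f -/

section Calculus

/-- The quantity `exp (c u) * (f' u - c f u)` is antitone. Were it positive at `s`, then `f'` would
stay above a positive constant on the whole left half-line, forcing `f` below zero there.
Nonnegativity on all of `ℝ` is thus essential. -/
theorem deriv_le_mul_of_deriv_deriv_le {f f' f'' : ℝ → ℝ} {c : ℝ} (hc : 0 ≤ c)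
    (hf : ∀ s, HasDerivAt f (f' s) s) (hf' : ∀ s, HasDerivAt f' (f'' s) s)
    (hnn : ∀ s, 0 ≤ f s) (h : ∀ s, f'' s ≤ c ^ 2 * f s) (s : ℝ) : f' s ≤ c * f s := by
  by_contra! hlt
  have hq : ∀ u, HasDerivAt (fun u => Real.exp (c * u) * (f' u - c * f u))
      (Real.exp (c * u) * (f'' u - c ^ 2 * f u)) u := by
    intro u
    have he : HasDerivAt (fun u => Real.exp (c * u)) (Real.exp (c * u) * c) u := by
      simpa using ((hasDerivAt_id u).const_mul c).exp
    refine (he.fun_mul ((hf' u).fun_sub ((hf u).const_mul c))).congr_deriv ?_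
    ring
  have hanti : Antitone fun u => Real.exp (c * u) * (f' u - c * f u) :=
    antitone_of_hasDerivAt_nonpos hq fun u =>
      mul_nonpos_of_nonneg_of_nonpos (Real.exp_pos _).le (by linarith [h u])
  set q := f' s - c * f s with hqdef
  have hq0 : 0 < q := by linarith
  have hlow : ∀ u ≤ s, q ≤ f' u := by
    intro u hu
    have h1 : Real.exp (c * s) * q ≤ Real.exp (c * u) * (f' u - c * f u) := hanti hu
    have h2 : Real.exp (c * u) * q ≤ Real.exp (c * s) * q := by gcongr
    have h3 : q ≤ f' u - c * f u := le_of_mul_le_mul_left (h2.trans h1) (Real.exp_pos _)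
    nlinarith [hnn u]
  -- Far enough to the left that slope at least `q` brings `f` down to `-1`.
  set u := s - (f s + 1) / q with hu
  have hus : u < s := by
    have : 0 < (f s + 1) / q := div_pos (by linarith [hnn s]) hq0
    linarith
  obtain ⟨ξ, hξ, hξ'⟩ := exists_hasDerivAt_eq_slope f f' hus
    (fun x _ => (hf x).continuousAt.continuousWithinAt) (fun x _ => hf x)
  have h4 := hlow ξ hξ.2.le
  rw [hξ', le_div_iff₀ (by linarith)] at h4
  have h5 : q * (s - u) = f s + 1 := by rw [hu]; field_simp; ring
  linarith [hnn u]

/-- From `f' ≤ c f` and `c ≤ 1` comes `f u ≤ f 0 * exp u` for `u ≥ 0`. Inserting this in `f'' ≤ c²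
f` and integrating twice leaves the coefficient `e - 2`, which is below `3/4`. -/
theorem le_add_of_deriv_deriv_le {f f' f'' : ℝ → ℝ} {c : ℝ} (hc : 0 ≤ c) (hc1 : c ≤ 1)
    (hf : ∀ s, HasDerivAt f (f' s) s) (hf' : ∀ s, HasDerivAt f' (f'' s) s)
    (hnn : ∀ s, 0 ≤ f s) (h : ∀ s, f'' s ≤ c ^ 2 * f s) :
    f 1 ≤ f 0 + f' 0 + 3 / 4 * c ^ 2 * f 0 := by
  have hexp : ∀ u, 0 ≤ u → f u ≤ f 0 * Real.exp u := by
    intro u hu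
    have hq : ∀ u, HasDerivAt (fun u => Real.exp (-(c * u)) * f u)
        (Real.exp (-(c * u)) * (f' u - c * f u)) u := by
      intro u
      have he : HasDerivAt (fun u => Real.exp (-(c * u))) (Real.exp (-(c * u)) * (-c)) u := by
        simpa using ((hasDerivAt_id u).const_mul c).neg.exp
      refine (he.mul (hf u)).congr_deriv ?_
      ring
    have hanti : Antitone fun u => Real.exp (-(c * u)) * f u :=
      antitone_of_hasDerivAt_nonpos hq fun u =>
        mul_nonpos_of_nonneg_of_nonpos (Real.exp_pos _).le
          (by linarith [deriv_le_mul_of_deriv_deriv_le hc hf hf' hnn h u])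
    have h1 : Real.exp (-(c * u)) * f u ≤ Real.exp (-(c * 0)) * f 0 := hanti hu
    have h2 : f u ≤ f 0 * Real.exp (c * u) := by
      rw [mul_zero, neg_zero, Real.exp_zero, one_mul, Real.exp_neg] at h1
      rwa [inv_mul_le_iff₀ (Real.exp_pos _), mul_comm] at h1
    refine h2.trans ?_
    have : c * u ≤ u := by nlinarith
    have := hnn 0
    gcongr
  have hd1 : ∀ u, 0 ≤ u → f' u ≤ f' 0 + c ^ 2 * f 0 * (Real.exp u - 1) := by
    intro u hu
    have hA : AntitoneOn (fun u => f' u - c ^ 2 * f 0 * (Real.exp u - 1)) (Set.Ici 0) := by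
      refine antitoneOn_of_hasDerivWithinAt_nonpos (convex_Ici 0)
        (f' := fun u => f'' u - c ^ 2 * f 0 * Real.exp u) ?_ ?_ ?_
      · intro u _
        exact ((hf' u).continuousAt.sub (by fun_prop)).continuousWithinAt
      · intro u _
        exact ((hf' u).sub (((Real.hasDerivAt_exp u).sub_const 1).const_mul _)).hasDerivWithinAt
      · intro u hu
        rw [interior_Ici] at hu
        have := mul_le_mul_of_nonneg_left (hexp u (le_of_lt hu)) (sq_nonneg c)
        linarith [h u]
    have := hA (Set.mem_Ici.2 le_rfl) (Set.mem_Ici.2 hu) hu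
    simp only [Real.exp_zero] at this
    linarith
  have hA : AntitoneOn (fun u => f u - (f' 0 * u + c ^ 2 * f 0 * (Real.exp u - u))) (Set.Ici 0) := by
    refine antitoneOn_of_hasDerivWithinAt_nonpos (convex_Ici 0)
      (f' := fun u => f' u - (f' 0 * 1 + c ^ 2 * f 0 * (Real.exp u - 1))) ?_ ?_ ?_
    · intro u _
      exact ((hf u).continuousAt.sub (by fun_prop)).continuousWithinAt
    · intro u _
      exact ((hf u).sub (((hasDerivAt_id u).const_mul _).add
        (((Real.hasDerivAt_exp u).sub (hasDerivAt_id u)).const_mul _))).hasDerivWithinAt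
    · intro u hu
      rw [interior_Ici] at hu
      linarith [hd1 u (le_of_lt hu)]
  have h1 := hA (Set.mem_Ici.2 le_rfl) (Set.mem_Ici.2 zero_le_one) zero_le_one
  simp only [Real.exp_zero] at h1
  have he := Real.exp_one_lt_d9
  have h0 : 0 ≤ c ^ 2 * f 0 := mul_nonneg (sq_nonneg _) (hnn 0)
  nlinarith

end Calculus

theorem traceCosh_add_le {E : Type*} [NormedAddCommGroup E] [InnerProductSpace ℝ E]
    [FiniteDimensional ℝ E] (N : ℕ) {A X : E →L[ℝ] E}
    (hA : (A : E →ₗ[ℝ] E).IsSymmetric) (hX : (X : E →ₗ[ℝ] E).IsSymmetric) (h1 : ‖X‖ ≤ 1) :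
    traceCosh N (A + X) ≤ traceCosh N A + traceSinh N A X + 3 / 4 * ‖X‖ ^ 2 * traceCosh N A := by
  choose f'' hf'' hle using exists_hasDerivAt_traceSinh N hA hX
  have := le_add_of_deriv_deriv_le (norm_nonneg X) h1 (hasDerivAt_traceCosh N A X) hf''
    (fun s => traceCosh_nonneg (by simpa using hA.add (hX.smul (c := s) (by simp))) N) hle
  simpa using this

/-! ### Measurability and symmetry of sampled Hessians; one noise step for the potential -/

section HessianMeasurability

theorem measurable_clm_of_apply {α ι E : Type*} [MeasurableSpace α] [Fintype ι]
    [NormedAddCommGroup E] [InnerProductSpace ℝ E] [FiniteDimensional ℝ E] [MeasurableSpace E]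
    [BorelSpace E] (b : OrthonormalBasis ι ℝ E) {A : α → E →L[ℝ] E}
    (h : ∀ v, Measurable fun a => A a v) : Measurable A := by
  have hA : A = fun a => ∑ i, ContinuousLinearMap.smulRightL ℝ E E (innerSL ℝ (b i)) (A a (b i)) := by
    funext a
    ext1 v
    simp only [sum_apply, ContinuousLinearMap.smulRightL_apply_apply]
    conv_lhs => rw [← b.sum_repr' v, map_sum]
    simp
  rw [hA]
  refine Finset.measurable_sum _ fun i _ => ?_
  exact (ContinuousLinearMap.continuous _).measurable.comp (h (b i))

theorem TwiceDifferentiable.hess_isSymmetric {d : ℕ} {g : EuclideanSpace ℝ (Fin d) → ℝ}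
    (hg : TwiceDifferentiable g) (x : EuclideanSpace ℝ (Fin d)) :
    (hess g x : EuclideanSpace ℝ (Fin d) →ₗ[ℝ] EuclideanSpace ℝ (Fin d)).IsSymmetric := by
  intro v w
  have h1 : ∀ y, HasFDerivAt g (innerSL ℝ (gradient g y)) y := fun y =>
    (hg.1 y).hasGradientAt.hasFDerivAt
  have h2 : HasFDerivAt (fun y => innerSL ℝ (gradient g y)) ((innerSL ℝ).comp (hess g x)) x :=
    (innerSL ℝ).hasFDerivAt.comp x (hg.2 x).hasFDerivAt
  have h3 := second_derivative_symmetric h1 h2 v w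
  simp only [ContinuousLinearMap.comp_apply, innerSL_apply_apply] at h3
  simp only [ContinuousLinearMap.coe_coe]
  rw [h3, real_inner_comm]

theorem measurable_gradient_param {d : ℕ} {S : Type*} [MeasurableSpace S]
    {F : S → EuclideanSpace ℝ (Fin d) → ℝ} (hm : ∀ x, Measurable fun s => F s x)
    (hd : ∀ s, Differentiable ℝ (F s)) (x : EuclideanSpace ℝ (Fin d)) :
    Measurable fun s => gradient (F s) x := by
  have h : ∀ v, Measurable fun s => fderiv ℝ (F s) x v := by
    intro v
    refine measurable_of_tendsto_metrizable (f := fun (n : ℕ) s =>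
      (n : ℝ) • (F s (x + (n : ℝ)⁻¹ • v) - F s x)) (fun n => ?_) ?_
    · exact ((hm _).sub (hm _)).const_smul (n : ℝ)
    · rw [tendsto_pi_nhds]
      intro s
      exact ((hd s x).hasFDerivAt.lim_real v).comp tendsto_natCast_atTop_atTop
  have h2 : (fun s => gradient (F s) x) = fun s => ∑ i, fderiv ℝ (F s) x
      (EuclideanSpace.basisFun (Fin d) ℝ i) • EuclideanSpace.basisFun (Fin d) ℝ i := by
    funext s
    rw [← (EuclideanSpace.basisFun (Fin d) ℝ).sum_repr' (gradient (F s) x)]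
    refine Finset.sum_congr rfl fun i _ => ?_
    rw [real_inner_comm, inner_gradient_left]
  rw [h2]
  exact Finset.measurable_sum _ fun i _ => (h _).smul_const _

/-- The gradient is continuous in the point and measurable in the sample, hence jointly measurable.
The Hessian is a pointwise limit of its difference quotients, so no continuity of the sampled
Hessians is required. -/
theorem measurable_hess_param {d : ℕ} {S : Type*} [MeasurableSpace S]
    {F : S → EuclideanSpace ℝ (Fin d) → ℝ} (hm : ∀ x, Measurable fun s => F s x)
    (hd : ∀ s, TwiceDifferentiable (F s)) :
    Measurable fun p : EuclideanSpace ℝ (Fin d) × S => hess (F p.2) p.1 := by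
  have hg : Measurable fun p : EuclideanSpace ℝ (Fin d) × S => gradient (F p.2) p.1 :=
    measurable_uncurry_of_continuous_of_measurable (u := fun x s => gradient (F s) x)
      (fun s => (hd s).2.continuous) (measurable_gradient_param hm fun s => (hd s).1)
  refine measurable_clm_of_apply (EuclideanSpace.basisFun (Fin d) ℝ) fun v => ?_
  refine measurable_of_tendsto_metrizable (f := fun (n : ℕ) p =>
    (n : ℝ) • (gradient (F p.2) (p.1 + (n : ℝ)⁻¹ • v) - gradient (F p.2) p.1)) (fun n => ?_) ?_
  · have h1 : Measurable fun p : EuclideanSpace ℝ (Fin d) × S =>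
        ((p.1 + (n : ℝ)⁻¹ • v, p.2) : EuclideanSpace ℝ (Fin d) × S) :=
      (measurable_fst.add_const _).prodMk measurable_snd
    exact ((hg.comp h1).sub hg).const_smul (n : ℝ)
  · rw [tendsto_pi_nhds]
    intro p
    exact (((hd p.2).2 p.1).hasFDerivAt.lim_real v).comp tendsto_natCast_atTop_atTop

variable {d : ℕ} {S : Type*} [MeasurableSpace S] {D : Measure S}
  {F : S → EuclideanSpace ℝ (Fin d) → ℝ} {L : ℝ}

theorem IsStochasticProblem.continuous_hess (hF : IsStochasticProblem D F L) :
    Continuous (hess (objective D F)) := by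
  have : LipschitzWith L.toNNReal (hess (objective D F)) := by
    refine LipschitzWith.of_dist_le_mul fun x y => ?_
    rw [dist_eq_norm, dist_eq_norm]
    refine (hF.hess_lipschitz x y).trans ?_
    gcongr
    exact Real.le_coe_toNNReal L
  exact this.continuous

/-- The noise of the sampled Hessian. -/
noncomputable def hessNoise (D : Measure S) (F : S → EuclideanSpace ℝ (Fin d) → ℝ)
    (x : EuclideanSpace ℝ (Fin d)) (s : S) :
    EuclideanSpace ℝ (Fin d) →L[ℝ] EuclideanSpace ℝ (Fin d) :=
  hess (F s) x - hess (objective D F) x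

theorem IsStochasticProblem.measurable_hessNoise (hF : IsStochasticProblem D F L) :
    Measurable fun p : EuclideanSpace ℝ (Fin d) × S => hessNoise D F p.1 p.2 :=
  (measurable_hess_param hF.measurable hF.sample_twiceDifferentiable).sub
    (hF.continuous_hess.measurable.comp measurable_fst)

theorem IsStochasticProblem.hessNoise_isSymmetric (hF : IsStochasticProblem D F L)
    (x : EuclideanSpace ℝ (Fin d)) (s : S) :
    (hessNoise D F x s : EuclideanSpace ℝ (Fin d) →ₗ[ℝ] EuclideanSpace ℝ (Fin d)).IsSymmetric := by
  have := ((hF.sample_twiceDifferentiable s).hess_isSymmetric x).sub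
    (hF.twiceDifferentiable.hess_isSymmetric x)
  simpa [hessNoise] using this

variable {σ δ : ℝ}

theorem HessianNoise.ae_norm_hessNoise_le (h : HessianNoise D F σ δ)
    (x : EuclideanSpace ℝ (Fin d)) : ∀ᵐ s ∂D, ‖hessNoise D F x s‖ ≤ δ := h.bound x

theorem HessianNoise.nonneg [IsProbabilityMeasure D] (h : HessianNoise D F σ δ) : 0 ≤ δ := by
  obtain ⟨s, hs⟩ := (h.bound 0).exists
  exact (norm_nonneg _).trans hs

theorem HessianNoise.integrable_hessNoise [IsProbabilityMeasure D]
    (hF : IsStochasticProblem D F L) (h : HessianNoise D F σ δ)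
    (x : EuclideanSpace ℝ (Fin d)) : Integrable (hessNoise D F x) D :=
  Integrable.of_bound
    (hF.measurable_hessNoise.comp measurable_prodMk_left).aestronglyMeasurable δ
    (h.ae_norm_hessNoise_le x)

theorem HessianNoise.integrable_norm_sq_hessNoise [IsProbabilityMeasure D]
    (hF : IsStochasticProblem D F L) (h : HessianNoise D F σ δ)
    (x : EuclideanSpace ℝ (Fin d)) : Integrable (fun s => ‖hessNoise D F x s‖ ^ 2) D := by
  refine Integrable.of_bound
    ((hF.measurable_hessNoise.comp measurable_prodMk_left).norm.pow_const 2).aestronglyMeasurable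
    (δ ^ 2) ?_
  filter_upwards [h.ae_norm_hessNoise_le x] with s hs
  rw [norm_pow, norm_norm]
  gcongr

theorem HessianNoise.integral_hessNoise [IsProbabilityMeasure D]
    (hF : IsStochasticProblem D F L) (h : HessianNoise D F σ δ)
    (x : EuclideanSpace ℝ (Fin d)) : ∫ s, hessNoise D F x s ∂D = 0 := by
  -- The almost sure bound makes the sampled Hessian integrable, so the mean in the noise assumption
  -- is a genuine Bochner integral.
  have h1 : Integrable (fun s => hess (F s) x) D := by
    have := (h.integrable_hessNoise hF x).add (integrable_const (hess (objective D F) x))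
    refine this.congr (Filter.Eventually.of_forall fun s => ?_)
    simp [hessNoise]
  simp only [hessNoise]
  rw [integral_sub h1 (integrable_const _), h.mean x]
  simp

/-- The condition `c * δ ≤ 1` keeps the increment in the range of `traceCosh_add_le`. Unbiasedness
removes the linear term, the variance bounds the quadratic one, and `1 + y ≤ exp y` makes the factor
multiplicative along steps. -/
theorem HessianNoise.lintegral_traceCosh_add_le [IsProbabilityMeasure D]
    (hF : IsStochasticProblem D F L) (h : HessianNoise D F σ δ) {c : ℝ} (hc : 0 ≤ c)
    (hcδ : c * δ ≤ 1) (N : ℕ) {A : EuclideanSpace ℝ (Fin d) →L[ℝ] EuclideanSpace ℝ (Fin d)}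
    (hA : (A : EuclideanSpace ℝ (Fin d) →ₗ[ℝ] EuclideanSpace ℝ (Fin d)).IsSymmetric)
    (x : EuclideanSpace ℝ (Fin d)) :
    ∫⁻ s, ENNReal.ofReal (traceCosh N (A + c • hessNoise D F x s)) ∂D
      ≤ ENNReal.ofReal (Real.exp (3 / 4 * (c ^ 2 * σ ^ 2))) * ENNReal.ofReal (traceCosh N A) := by
  have hpos := traceCosh_nonneg hA N
  have hsym : ∀ s, ((c • hessNoise D F x s :
      EuclideanSpace ℝ (Fin d) →L[ℝ] EuclideanSpace ℝ (Fin d)) :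
      EuclideanSpace ℝ (Fin d) →ₗ[ℝ] EuclideanSpace ℝ (Fin d)).IsSymmetric := by
    intro s
    simpa using (hF.hessNoise_isSymmetric x s).smul (c := c) (by simp)
  set G : S → ℝ := fun s => traceCosh N A + c * traceSinh N A (hessNoise D F x s)
    + 3 / 4 * c ^ 2 * traceCosh N A * ‖hessNoise D F x s‖ ^ 2 with hG
  have hle : ∀ᵐ s ∂D, traceCosh N (A + c • hessNoise D F x s) ≤ G s := by
    filter_upwards [h.ae_norm_hessNoise_le x] with s hs
    have hn : ‖c • hessNoise D F x s‖ = c * ‖hessNoise D F x s‖ := by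
      rw [norm_smul, Real.norm_of_nonneg hc]
    have h1 : ‖c • hessNoise D F x s‖ ≤ 1 := by
      rw [hn]
      exact (mul_le_mul_of_nonneg_left hs hc).trans hcδ
    refine (traceCosh_add_le N hA (hsym s) h1).trans (le_of_eq ?_)
    rw [hn, map_smul, smul_eq_mul, hG]
    ring
  have hi1 : Integrable (fun s => traceSinh N A (hessNoise D F x s)) D :=
    (traceSinh N A).integrable_comp (h.integrable_hessNoise hF x)
  have hi2 := h.integrable_norm_sq_hessNoise hF x
  have hi3 : Integrable (fun s => traceCosh N A + c * traceSinh N A (hessNoise D F x s)) D :=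
    (integrable_const _).add (hi1.const_mul c)
  have hGi : Integrable G D := hi3.add (hi2.const_mul _)
  have hGnn : 0 ≤ᵐ[D] G := by
    filter_upwards [hle] with s hs
    have h0 : ((A + c • hessNoise D F x s :
        EuclideanSpace ℝ (Fin d) →L[ℝ] EuclideanSpace ℝ (Fin d)) :
        EuclideanSpace ℝ (Fin d) →ₗ[ℝ] EuclideanSpace ℝ (Fin d)).IsSymmetric := by
      simpa using hA.add (hsym s)
    exact (traceCosh_nonneg h0 N).trans hs
  have hGint : ∫ s, G s ∂D ≤ Real.exp (3 / 4 * (c ^ 2 * σ ^ 2)) * traceCosh N A := by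
    have e1 : ∫ s, G s ∂D = traceCosh N A
        + 3 / 4 * c ^ 2 * traceCosh N A * ∫ s, ‖hessNoise D F x s‖ ^ 2 ∂D := by
      rw [hG, integral_add hi3 (hi2.const_mul _),
        integral_add (integrable_const _) (hi1.const_mul c), integral_const_mul, integral_const_mul,
        ContinuousLinearMap.integral_comp_comm _ (h.integrable_hessNoise hF x),
        h.integral_hessNoise hF x]
      simp
    have h2 : ∫ s, ‖hessNoise D F x s‖ ^ 2 ∂D ≤ σ ^ 2 := h.variance x
    have h3 : 3 / 4 * c ^ 2 * traceCosh N A * ∫ s, ‖hessNoise D F x s‖ ^ 2 ∂D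
        ≤ 3 / 4 * c ^ 2 * traceCosh N A * σ ^ 2 := by gcongr
    have h4 := mul_le_mul_of_nonneg_right (Real.add_one_le_exp (3 / 4 * (c ^ 2 * σ ^ 2))) hpos
    rw [e1]
    linarith
  calc ∫⁻ s, ENNReal.ofReal (traceCosh N (A + c • hessNoise D F x s)) ∂D
      ≤ ∫⁻ s, ENNReal.ofReal (G s) ∂D :=
        lintegral_mono_ae (hle.mono fun s hs => ENNReal.ofReal_le_ofReal hs)
    _ = ENNReal.ofReal (∫ s, G s ∂D) := (ofReal_integral_eq_lintegral_ofReal hGi hGnn).symm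
    _ ≤ ENNReal.ofReal (Real.exp (3 / 4 * (c ^ 2 * σ ^ 2)) * traceCosh N A) :=
        ENNReal.ofReal_le_ofReal hGint
    _ = _ := ENNReal.ofReal_mul (Real.exp_pos _).le

end HessianMeasurability

/-! ### Exponential and third moments of the accumulated noise -/

section NoiseMomentum

theorem lintegral_of_indep {Ω α S : Type*} {m mΩ : MeasurableSpace Ω} [MeasurableSpace α]
    [MeasurableSpace S] {P : Measure Ω} [IsFiniteMeasure P] {D : Measure S} [SFinite D]
    (hm : m ≤ mΩ) {Z : Ω → α} (hZ : Measurable[m] Z) {ξ : Ω → S} (hξ : Measurable ξ)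
    (hlaw : P.map ξ = D) (hind : Indep (MeasurableSpace.comap ξ inferInstance) m P)
    {G : α × S → ℝ≥0∞} (hG : Measurable G) :
    ∫⁻ ω, G (Z ω, ξ ω) ∂P = ∫⁻ ω, ∫⁻ s, G (Z ω, s) ∂D ∂P := by
  have hZ' : Measurable Z := hZ.mono hm le_rfl
  have hi : IndepFun Z ξ P := by
    rw [IndepFun_iff_Indep]
    exact indep_of_indep_of_le_left hind.symm hZ.comap_le
  have hmap := (indepFun_iff_map_prod_eq_prod_map_map hZ'.aemeasurable hξ.aemeasurable).1 hi
  rw [← lintegral_map (f := G) hG (hZ'.prodMk hξ), hmap, hlaw, lintegral_prod _ hG.aemeasurable,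
    lintegral_map hG.lintegral_prod_right' hZ']

/-- The contribution of the sampling noise to the momentum estimate. -/
noncomputable def noiseMomentum {d : ℕ} {S : Type*} [MeasurableSpace S] (D : Measure S)
    (F : S → EuclideanSpace ℝ (Fin d) → ℝ) (β : ℝ) (x : ℕ → EuclideanSpace ℝ (Fin d))
    (s : ℕ → S) : ℕ → EuclideanSpace ℝ (Fin d) →L[ℝ] EuclideanSpace ℝ (Fin d)
  | 0 => 0
  | t + 1 => (1 - β) • noiseMomentum D F β x s t + β • hessNoise D F (x (t + 1)) (s (t + 1))

theorem continuous_traceCosh {E : Type*} [NormedAddCommGroup E] [InnerProductSpace ℝ E]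
    [FiniteDimensional ℝ E] (N : ℕ) : Continuous fun A : E →L[ℝ] E => traceCosh N A := by
  unfold traceCosh
  fun_prop

theorem traceCosh_zero_le {E : Type*} [NormedAddCommGroup E] [InnerProductSpace ℝ E]
    [FiniteDimensional ℝ E] (N : ℕ) : traceCosh N (0 : E →L[ℝ] E) ≤ Module.finrank ℝ E := by
  rcases N with _ | N
  · simp [traceCosh]
  · rw [traceCosh, Finset.sum_range_succ', Finset.sum_eq_zero]
    · simp [opTrace_one]
    · intro m _
      simp

theorem sum_norm_pow_le_traceCosh {E : Type*} [NormedAddCommGroup E] [InnerProductSpace ℝ E]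
    [FiniteDimensional ℝ E] [Nontrivial E] {A : E →L[ℝ] E}
    (hA : (A : E →ₗ[ℝ] E).IsSymmetric) (N : ℕ) :
    ∑ m ∈ Finset.range N, ‖A‖ ^ (2 * m) / (2 * m).factorial ≤ traceCosh N A :=
  Finset.sum_le_sum fun m _ => by
    have := norm_pow_even_le_opTrace hA m
    gcongr

/-- For `t = a + w` with `w ≥ 0`, the cubic Taylor polynomial of `exp w` times `3 a²` dominates the
expansion of `(a + w)³ - a³` term by term once `a ≥ 2`. -/
theorem cube_le_cube_add_exp {a t : ℝ} (ha : 2 ≤ a) (ht : 0 ≤ t) :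
    t ^ 3 ≤ a ^ 3 + 3 * a ^ 2 * Real.exp (t - a) := by
  rcases le_total t a with h | h
  · have h1 : t ^ 3 ≤ a ^ 3 := by gcongr
    have := Real.exp_pos (t - a)
    have : 0 ≤ 3 * a ^ 2 * Real.exp (t - a) := by positivity
    linarith
  · obtain ⟨w, rfl⟩ : ∃ w, t = a + w := ⟨t - a, by ring⟩
    have hw : 0 ≤ w := by linarith
    have h1 := Real.sum_le_exp_of_nonneg hw 4
    simp only [Finset.sum_range_succ, Finset.sum_range_zero, Nat.factorial] at h1
    norm_num at h1
    have h2 := mul_le_mul_of_nonneg_left h1 (by positivity : 0 ≤ 3 * a ^ 2)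
    rw [add_sub_cancel_left]
    have h3 : 3 * a * w ^ 2 ≤ 3 / 2 * a ^ 2 * w ^ 2 :=
      mul_le_mul_of_nonneg_right (by nlinarith) (sq_nonneg w)
    have h4 : w ^ 3 ≤ 1 / 2 * a ^ 2 * w ^ 3 := by
      have : 0 ≤ w ^ 3 := by positivity
      nlinarith
    nlinarith [sq_nonneg a]

variable {Ω S : Type*} [mΩ : MeasurableSpace Ω] [MeasurableSpace S] {d b : ℕ}
  {P : Measure Ω} {D : Measure S} {F : S → EuclideanSpace ℝ (Fin d) → ℝ} {L σ δ β : ℝ}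
  {ℱ : Filtration ℕ mΩ} {x₀ : EuclideanSpace ℝ (Fin d)}
  {x : ℕ → Ω → EuclideanSpace ℝ (Fin d)} {ζ : Fin b → Ω → S} {ξ : ℕ → Ω → S}

theorem IsStochasticProblem.noiseMomentum_isSymmetric (hF : IsStochasticProblem D F L)
    (y : ℕ → EuclideanSpace ℝ (Fin d)) (s : ℕ → S) (t : ℕ) :
    (noiseMomentum D F β y s t :
      EuclideanSpace ℝ (Fin d) →ₗ[ℝ] EuclideanSpace ℝ (Fin d)).IsSymmetric := by
  induction t with
  | zero => simp [noiseMomentum]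
  | succ t ih =>
    simpa [noiseMomentum] using (ih.smul (c := 1 - β) (by simp)).add
      ((hF.hessNoise_isSymmetric (y (t + 1)) (s (t + 1))).smul (c := β) (by simp))

theorem IsSampledRun.measurable_noiseMomentum (hrun : IsSampledRun P D ℱ x₀ x ζ ξ)
    (hF : IsStochasticProblem D F L) (t : ℕ) :
    Measurable[ℱ (t + 1)] fun ω => noiseMomentum D F β (fun k => x k ω) (fun k => ξ k ω) t := by
  induction t with
  | zero => exact measurable_const
  | succ t ih =>
    have h1 := ih.mono (ℱ.mono (Nat.le_succ (t + 1))) le_rfl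
    have h2 := (hrun.iterate_measurable (t + 1)).mono (ℱ.mono (Nat.le_succ (t + 1))) le_rfl
    have h3 := hrun.sample_measurable (t + 1) (Nat.le_add_left 1 t)
    have h4 : Measurable[ℱ (t + 2)] fun ω => hessNoise D F (x (t + 1) ω) (ξ (t + 1) ω) :=
      
      hF.measurable_hessNoise.comp (f := fun ω => (x (t + 1) ω, ξ (t + 1) ω)) (h2.prodMk h3)
    exact (h1.const_smul (1 - β)).add (h4.const_smul β)

-- Conditioning on the past freezes `U_t` and the point `x (t + 1)`, and the fresh sample costs one
-- variance factor. What remains is the potential of `U_t` at the smaller parameter `θ * (1 - β)`,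
-- hence the induction over all `θ`. The hypothesis `hv` says that `v` is preserved by the variance
-- recursion.
set_option maxHeartbeats 400000 in
theorem IsSampledRun.lintegral_traceCosh_noiseMomentum_le [IsProbabilityMeasure P]
    [IsProbabilityMeasure D] (hrun : IsSampledRun P D ℱ x₀ x ζ ξ)
    (hF : IsStochasticProblem D F L) (hN : HessianNoise D F σ δ) (hβ0 : 0 ≤ β) (hβ1 : β ≤ 1)
    {v : ℝ} (hv0 : 0 ≤ v) (hv : (1 - β) ^ 2 * v + β ^ 2 * σ ^ 2 ≤ v) (N t : ℕ) {θ : ℝ}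
    (hθ : 0 ≤ θ) (hθδ : θ * (β * δ) ≤ 1) :
    ∫⁻ ω, ENNReal.ofReal (traceCosh N
        (θ • noiseMomentum D F β (fun k => x k ω) (fun k => ξ k ω) t)) ∂P
      ≤ ENNReal.ofReal (d * Real.exp (3 / 4 * (θ ^ 2 * v))) := by
  have hδ := hN.nonneg
  induction t generalizing θ with
  | zero =>
    have h0 : ∀ ω, θ • noiseMomentum D F β (fun k => x k ω) (fun k => ξ k ω) 0 = 0 :=
      fun ω => smul_zero (A := EuclideanSpace ℝ (Fin d) →L[ℝ] EuclideanSpace ℝ (Fin d)) θ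
    simp only [h0, lintegral_const, measure_univ, mul_one]
    refine ENNReal.ofReal_le_ofReal ((traceCosh_zero_le N).trans ?_)
    rw [finrank_euclideanSpace_fin]
    exact le_mul_of_one_le_right (Nat.cast_nonneg d) (Real.one_le_exp (by positivity))
  | succ t ih =>
    set U : Ω → EuclideanSpace ℝ (Fin d) →L[ℝ] EuclideanSpace ℝ (Fin d) :=
      fun ω => noiseMomentum D F β (fun k => x k ω) (fun k => ξ k ω) t with hU
    have hβ1' : 0 ≤ 1 - β := by linarith
    have hθ1 : 0 ≤ θ * (1 - β) := by positivity
    have hθ1' : θ * (1 - β) * (β * δ) ≤ 1 := by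
      have h0 : 0 ≤ θ * (β * δ) := by positivity
      nlinarith
    have hih := ih hθ1 hθ1'
    have hmeas : Measurable[ℱ (t + 1)] fun ω => (U ω, x (t + 1) ω) :=
      (hrun.measurable_noiseMomentum hF t).prodMk (hrun.iterate_measurable (t + 1))
    set G : ((EuclideanSpace ℝ (Fin d) →L[ℝ] EuclideanSpace ℝ (Fin d)) ×
        EuclideanSpace ℝ (Fin d)) × S → ℝ≥0∞ := fun p => ENNReal.ofReal
      (traceCosh N ((θ * (1 - β)) • p.1.1 + (θ * β) • hessNoise D F p.1.2 p.2)) with hG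
    have hGm : Measurable G := by
      have h1 : Measurable fun p : ((EuclideanSpace ℝ (Fin d) →L[ℝ] EuclideanSpace ℝ (Fin d)) ×
          EuclideanSpace ℝ (Fin d)) × S => hessNoise D F p.1.2 p.2 :=
        hF.measurable_hessNoise.comp (f := fun p : ((EuclideanSpace ℝ (Fin d) →L[ℝ]
          EuclideanSpace ℝ (Fin d)) × EuclideanSpace ℝ (Fin d)) × S => (p.1.2, p.2))
          (measurable_fst.snd.prodMk measurable_snd)
      exact ((continuous_traceCosh N).measurable.comp
        ((measurable_fst.fst.const_smul (θ * (1 - β))).add (h1.const_smul (θ * β)))).ennreal_ofReal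
    have hθβ : 0 ≤ θ * β := by positivity
    have hθβδ : θ * β * δ ≤ 1 := by linarith
    have hsym : ∀ ω, (((θ * (1 - β)) • U ω :
        EuclideanSpace ℝ (Fin d) →L[ℝ] EuclideanSpace ℝ (Fin d)) :
        EuclideanSpace ℝ (Fin d) →ₗ[ℝ] EuclideanSpace ℝ (Fin d)).IsSymmetric := fun ω => by
      simpa using (hF.noiseMomentum_isSymmetric (fun k => x k ω) (fun k => ξ k ω) t).smul
        (c := θ * (1 - β)) (by simp)
    calc ∫⁻ ω, ENNReal.ofReal (traceCosh N
          (θ • noiseMomentum D F β (fun k => x k ω) (fun k => ξ k ω) (t + 1))) ∂P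
        = ∫⁻ ω, G ((U ω, x (t + 1) ω), ξ (t + 1) ω) ∂P := by
          simp only [hG, hU, noiseMomentum, smul_add, smul_smul]
      _ = ∫⁻ ω, ∫⁻ s, G ((U ω, x (t + 1) ω), s) ∂D ∂P :=
          lintegral_of_indep (Z := fun ω => (U ω, x (t + 1) ω)) (ξ := ξ (t + 1)) (G := G)
            (ℱ.le (t + 1)) hmeas
            ((hrun.sample_measurable (t + 1) (Nat.le_add_left 1 t)).mono (ℱ.le _) le_rfl)
            (hrun.sample_law (t + 1) (Nat.le_add_left 1 t))
            (hrun.sample_indep (t + 1) (Nat.le_add_left 1 t)) hGm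
      _ ≤ ∫⁻ ω, ENNReal.ofReal (Real.exp (3 / 4 * ((θ * β) ^ 2 * σ ^ 2)))
            * ENNReal.ofReal (traceCosh N ((θ * (1 - β)) • U ω)) ∂P := by
          refine lintegral_mono fun ω => ?_
          exact hN.lintegral_traceCosh_add_le hF (c := θ * β) (A := (θ * (1 - β)) • U ω)
            hθβ hθβδ N (hsym ω) (x (t + 1) ω)
      _ = ENNReal.ofReal (Real.exp (3 / 4 * ((θ * β) ^ 2 * σ ^ 2)))
            * ∫⁻ ω, ENNReal.ofReal (traceCosh N ((θ * (1 - β)) • U ω)) ∂P :=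
          lintegral_const_mul' _ _ ENNReal.ofReal_ne_top
      _ ≤ ENNReal.ofReal (Real.exp (3 / 4 * ((θ * β) ^ 2 * σ ^ 2)))
            * ENNReal.ofReal (d * Real.exp (3 / 4 * ((θ * (1 - β)) ^ 2 * v))) := by gcongr
      _ ≤ _ := by
          rw [← ENNReal.ofReal_mul (Real.exp_pos _).le]
          refine ENNReal.ofReal_le_ofReal ?_
          rw [mul_left_comm, ← Real.exp_add]
          gcongr
          have := mul_le_mul_of_nonneg_left hv (sq_nonneg θ)
          nlinarith

/-- The bound on the truncated potential is uniform in `N`, so it bounds every partial sum of the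
termwise integrated cosh series. -/
theorem IsSampledRun.lintegral_cosh_noiseMomentum_le [IsProbabilityMeasure P]
    [IsProbabilityMeasure D] (hd : 1 ≤ d) (hrun : IsSampledRun P D ℱ x₀ x ζ ξ)
    (hF : IsStochasticProblem D F L) (hN : HessianNoise D F σ δ) (hβ0 : 0 ≤ β) (hβ1 : β ≤ 1)
    {v : ℝ} (hv0 : 0 ≤ v) (hv : (1 - β) ^ 2 * v + β ^ 2 * σ ^ 2 ≤ v) (t : ℕ) {θ : ℝ}
    (hθ : 0 ≤ θ) (hθδ : θ * (β * δ) ≤ 1) :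
    ∫⁻ ω, ENNReal.ofReal (Real.cosh
        (θ * ‖noiseMomentum D F β (fun k => x k ω) (fun k => ξ k ω) t‖)) ∂P
      ≤ ENNReal.ofReal (d * Real.exp (3 / 4 * (θ ^ 2 * v))) := by
  have : Nonempty (Fin d) := ⟨⟨0, hd⟩⟩
  set U : Ω → EuclideanSpace ℝ (Fin d) →L[ℝ] EuclideanSpace ℝ (Fin d) :=
    fun ω => noiseMomentum D F β (fun k => x k ω) (fun k => ξ k ω) t with hU
  have hUm : Measurable U := (hrun.measurable_noiseMomentum hF t).mono (ℱ.le _) le_rfl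
  have hterm : ∀ (m : ℕ) ω, 0 ≤ (θ * ‖U ω‖) ^ (2 * m) / (2 * m).factorial := fun m ω => by
    positivity
  have h1 : ∀ ω, ENNReal.ofReal (Real.cosh (θ * ‖U ω‖))
      = ∑' m : ℕ, ENNReal.ofReal ((θ * ‖U ω‖) ^ (2 * m) / (2 * m).factorial) := fun ω => by
    rw [Real.cosh_eq_tsum, ENNReal.ofReal_tsum_of_nonneg (fun m => hterm m ω)
      (Real.hasSum_cosh _).summable]
  have hm : ∀ m : ℕ, Measurable fun ω =>
      ENNReal.ofReal ((θ * ‖U ω‖) ^ (2 * m) / (2 * m).factorial) := fun m =>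
    (((hUm.norm.const_mul θ).pow_const (2 * m)).div_const _).ennreal_ofReal
  calc ∫⁻ ω, ENNReal.ofReal (Real.cosh (θ * ‖U ω‖)) ∂P
      = ∑' m : ℕ, ∫⁻ ω, ENNReal.ofReal ((θ * ‖U ω‖) ^ (2 * m) / (2 * m).factorial) ∂P := by
        simp only [h1]
        exact lintegral_tsum fun m => (hm m).aemeasurable
    _ ≤ _ := by
        refine ENNReal.tsum_le_of_sum_range_le fun N => ?_
        rw [← lintegral_finsetSum _ fun m _ => hm m]
        refine (lintegral_mono fun ω => ?_).trans
          (hrun.lintegral_traceCosh_noiseMomentum_le hF hN hβ0 hβ1 hv0 hv N t hθ hθδ)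
        rw [← ENNReal.ofReal_sum_of_nonneg fun m _ => hterm m ω]
        refine ENNReal.ofReal_le_ofReal ?_
        have hs : ((θ • U ω : EuclideanSpace ℝ (Fin d) →L[ℝ] EuclideanSpace ℝ (Fin d)) :
            EuclideanSpace ℝ (Fin d) →ₗ[ℝ] EuclideanSpace ℝ (Fin d)).IsSymmetric := by
          simpa using (hF.noiseMomentum_isSymmetric (fun k => x k ω) (fun k => ξ k ω) t).smul
            (c := θ) (by simp)
        have h2 := sum_norm_pow_le_traceCosh hs N
        rwa [norm_smul, Real.norm_of_nonneg hθ] at h2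

/-- With `θ = 1/η` the expected cosh is at most `d * d³`. Cutting the scaled norm at `5 log d` gains
`d⁻⁵`, so the exponential tail contributes only a factor `1/d ≤ 1/2`. -/
theorem IsSampledRun.lintegral_noiseMomentum_cube_le_of_pos [IsProbabilityMeasure P]
    [IsProbabilityMeasure D] (hd : 2 ≤ d) (hrun : IsSampledRun P D ℱ x₀ x ζ ξ)
    (hF : IsStochasticProblem D F L) (hN : HessianNoise D F σ δ) (hβ0 : 0 ≤ β) (hβ1 : β ≤ 1)
    {v : ℝ} (hv0 : 0 ≤ v) (hv : (1 - β) ^ 2 * v + β ^ 2 * σ ^ 2 ≤ v) (t : ℕ) {η : ℝ}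
    (hη : 0 < η) (hηδ : β * δ ≤ η) (hηv : v ≤ 4 * Real.log d * η ^ 2) :
    ∫⁻ ω, ‖noiseMomentum D F β (fun k => x k ω) (fun k => ξ k ω) t‖ₑ ^ 3 ∂P
      ≤ ENNReal.ofReal (240 * (Real.log d * η) ^ 3) := by
  set l := Real.log d with hl
  have hd' : (2 : ℝ) ≤ d := by exact_mod_cast hd
  have hl2 : 0.6931 ≤ l := by
    have := Real.log_two_gt_d9
    have := Real.log_le_log (by norm_num) hd'
    linarith
  set U : Ω → EuclideanSpace ℝ (Fin d) →L[ℝ] EuclideanSpace ℝ (Fin d) :=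
    fun ω => noiseMomentum D F β (fun k => x k ω) (fun k => ξ k ω) t with hU
  have hcosh := hrun.lintegral_cosh_noiseMomentum_le (by omega : 1 ≤ d) hF hN hβ0 hβ1 hv0 hv t
    (θ := η⁻¹) (by positivity) (by rwa [inv_mul_le_iff₀ hη, mul_one])
  have hexp : 3 / 4 * (η⁻¹ ^ 2 * v) ≤ 3 * l := by
    have : η⁻¹ ^ 2 * v ≤ 4 * l := by
      rw [inv_pow, inv_mul_le_iff₀ (by positivity)]
      linarith
    linarith
  have hdl : (d : ℝ) = Real.exp l := (Real.exp_log (by linarith)).symm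
  have hpt : ∀ ω, ‖U ω‖ₑ ^ 3 ≤ ENNReal.ofReal (η ^ 3 * (5 * l) ^ 3)
      + ENNReal.ofReal (η ^ 3 * (6 * (5 * l) ^ 2 * Real.exp (-(5 * l))))
        * ENNReal.ofReal (Real.cosh (η⁻¹ * ‖U ω‖)) := by
    intro ω
    rw [← ofReal_norm, ← ENNReal.ofReal_pow (norm_nonneg _),
      ← ENNReal.ofReal_mul (by positivity), ← ENNReal.ofReal_add (by positivity) (by positivity)]
    refine ENNReal.ofReal_le_ofReal ?_
    have h1 := cube_le_cube_add_exp (a := 5 * l) (t := η⁻¹ * ‖U ω‖) (by linarith) (by positivity)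
    have h2 : Real.exp (η⁻¹ * ‖U ω‖) ≤ 2 * Real.cosh (η⁻¹ * ‖U ω‖) := by
      rw [Real.cosh_eq]
      linarith [Real.exp_pos (-(η⁻¹ * ‖U ω‖))]
    have h3 : ‖U ω‖ ^ 3 = η ^ 3 * (η⁻¹ * ‖U ω‖) ^ 3 := by field_simp
    rw [h3, mul_assoc, ← mul_add]
    refine mul_le_mul_of_nonneg_left (h1.trans ?_) (by positivity)
    rw [sub_eq_add_neg, Real.exp_add]
    have h4 := mul_le_mul_of_nonneg_left h2
      (by positivity : 0 ≤ 3 * (5 * l) ^ 2 * Real.exp (-(5 * l)))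
    linarith
  calc ∫⁻ ω, ‖U ω‖ₑ ^ 3 ∂P
      ≤ ∫⁻ ω, (ENNReal.ofReal (η ^ 3 * (5 * l) ^ 3)
      + ENNReal.ofReal (η ^ 3 * (6 * (5 * l) ^ 2 * Real.exp (-(5 * l))))
        * ENNReal.ofReal (Real.cosh (η⁻¹ * ‖U ω‖))) ∂P := lintegral_mono hpt
    _ = ENNReal.ofReal (η ^ 3 * (5 * l) ^ 3)
      + ENNReal.ofReal (η ^ 3 * (6 * (5 * l) ^ 2 * Real.exp (-(5 * l))))
        * ∫⁻ ω, ENNReal.ofReal (Real.cosh (η⁻¹ * ‖U ω‖)) ∂P := by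
        rw [lintegral_add_left measurable_const, lintegral_const_mul' _ _ ENNReal.ofReal_ne_top]
        simp
    _ ≤ ENNReal.ofReal (η ^ 3 * (5 * l) ^ 3)
      + ENNReal.ofReal (η ^ 3 * (6 * (5 * l) ^ 2 * Real.exp (-(5 * l))))
        * ENNReal.ofReal (d * Real.exp (3 / 4 * (η⁻¹ ^ 2 * v))) := by gcongr
    _ ≤ _ := by
        rw [← ENNReal.ofReal_mul (by positivity), ← ENNReal.ofReal_add (by positivity)
          (by positivity)]
        refine ENNReal.ofReal_le_ofReal ?_
        have h5 : Real.exp (-(5 * l)) * (d * Real.exp (3 / 4 * (η⁻¹ ^ 2 * v))) ≤ 1 / 2 := by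
          calc Real.exp (-(5 * l)) * (d * Real.exp (3 / 4 * (η⁻¹ ^ 2 * v)))
              ≤ Real.exp (-(5 * l)) * (Real.exp l * Real.exp (3 * l)) := by
                rw [hdl]; gcongr
            _ = (d : ℝ)⁻¹ := by
                rw [← Real.exp_add, ← Real.exp_add, hdl, ← Real.exp_neg]
                congr 1
                ring
            _ ≤ 1 / 2 := by
                rw [one_div]
                exact inv_anti₀ (by norm_num) hd'
        have h6 := mul_le_mul_of_nonneg_left h5 (by positivity : 0 ≤ η ^ 3 * (6 * (5 * l) ^ 2))
        -- The cut contributes `125 l³` and the tail `75 l²`; since `l ≥ log 2 > 75/115`, the total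
        -- is at most `240 l³`.
        have h7 : 75 * l ^ 2 ≤ 115 * l ^ 3 := by nlinarith [sq_nonneg l]
        have h8 := mul_le_mul_of_nonneg_left h7 (by positivity : 0 ≤ η ^ 3)
        linarith

/-- Includes the noiseless case `η = 0`, where `θ = 1/η` is unavailable, by letting `ε` decrease to
`η`. -/
theorem IsSampledRun.lintegral_noiseMomentum_cube_le [IsProbabilityMeasure P]
    [IsProbabilityMeasure D] (hd : 2 ≤ d) (hrun : IsSampledRun P D ℱ x₀ x ζ ξ)
    (hF : IsStochasticProblem D F L) (hN : HessianNoise D F σ δ) (hβ0 : 0 ≤ β) (hβ1 : β ≤ 1)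
    {v : ℝ} (hv0 : 0 ≤ v) (hv : (1 - β) ^ 2 * v + β ^ 2 * σ ^ 2 ≤ v) (t : ℕ) {η : ℝ}
    (hη : 0 ≤ η) (hηδ : β * δ ≤ η) (hηv : v ≤ 4 * Real.log d * η ^ 2) :
    ∫⁻ ω, ‖noiseMomentum D F β (fun k => x k ω) (fun k => ξ k ω) t‖ₑ ^ 3 ∂P
      ≤ ENNReal.ofReal (240 * (Real.log d * η) ^ 3) := by
  have hcont : Continuous fun ε : ℝ => ENNReal.ofReal (240 * (Real.log d * ε) ^ 3) :=
    ENNReal.continuous_ofReal.comp (by fun_prop)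
  refine ge_of_tendsto (hcont.continuousWithinAt (s := Set.Ioi η) (x := η)).tendsto ?_
  filter_upwards [self_mem_nhdsWithin] with ε hε
  have hε' : η < ε := hε
  refine hrun.lintegral_noiseMomentum_cube_le_of_pos hd hF hN hβ0 hβ1 hv0 hv t
    (hη.trans_lt hε') (hηδ.trans hε'.le) (hηv.trans ?_)
  have : 0 ≤ Real.log d := Real.log_natCast_nonneg d
  gcongr

end NoiseMomentum

/-! ### Splitting the error into initial, drift and noise parts -/

section ErrorDecomposition

/-- Jensen for the cube with weights `(1 - β)/3`, `(1 - β)/3`, `(1 + 2β)/3`. They keep a factor `1 -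
β` on the first two terms, and the noise coefficient falls from `9` to `1` as `β` goes from `0` to
`1`. -/
theorem add_cube_le_of_momentum {β a w u : ℝ} (hβ0 : 0 ≤ β) (hβ1 : β ≤ 1) (ha : 0 ≤ a)
    (hw : 0 ≤ w) (hu : 0 ≤ u) :
    ((1 - β) * a + (1 - β) * w + u) ^ 3
      ≤ 9 * (1 - β) * a ^ 3 + 9 * (1 - β) * w ^ 3 + 9 / (1 + 2 * β) ^ 2 * u ^ 3 := by
  have h := Real.pow_arith_mean_le_arith_mean_pow (Finset.univ : Finset (Fin 3))
    ![(1 - β) / 3, (1 - β) / 3, (1 + 2 * β) / 3] ![3 * a, 3 * w, 3 * u / (1 + 2 * β)]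
    (by
      intro i _
      fin_cases i
      · simpa using by linarith
      · simpa using by linarith
      · simpa using by linarith)
    (by simp [Fin.sum_univ_three]; ring)
    (by
      intro i _
      fin_cases i
      · simpa using ha
      · simpa using hw
      · simpa using by positivity) 3
  simp only [Fin.sum_univ_three, Matrix.cons_val] at h
  have hne : (1 + 2 * β) ≠ 0 := by positivity
  calc ((1 - β) * a + (1 - β) * w + u) ^ 3
      = ((1 - β) / 3 * (3 * a) + (1 - β) / 3 * (3 * w)
          + (1 + 2 * β) / 3 * (3 * u / (1 + 2 * β))) ^ 3 := by
        congr 1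
        field_simp
    _ ≤ _ := h
    _ = _ := by
        field_simp
        ring

theorem add_cube_le_of_contraction {β a c : ℝ} (hβ0 : 0 < β) (hβ1 : β ≤ 1) (ha : 0 ≤ a)
    (hc : 0 ≤ c) : ((1 - β) * a + c) ^ 3 ≤ (1 - β) * a ^ 3 + c ^ 3 / β ^ 2 := by
  have h := (convexOn_pow (𝕜 := ℝ) 3).2 (Set.mem_Ici.2 ha)
    (Set.mem_Ici.2 (div_nonneg hc hβ0.le)) (by linarith : 0 ≤ 1 - β) hβ0.le (by ring)
  simp only [smul_eq_mul] at h
  have e1 : β * (c / β) = c := by field_simp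
  have e2 : β * (c / β) ^ 3 = c ^ 3 / β ^ 2 := by field_simp
  rwa [e1, e2] at h

/-- The contribution of the movement of the iterates to the momentum estimate of `h (x t)`. -/
noncomputable def driftMomentum {E V : Type*} [NormedAddCommGroup V] [NormedSpace ℝ V]
    (h : E → V) (β : ℝ) (x : ℕ → E) : ℕ → V
  | 0 => 0
  | t + 1 => (1 - β) • driftMomentum h β x t + (h (x t) - h (x (t + 1)))

/-- Each step contracts the cubed norm by `1 - β` and adds `(L r_t)³ / β²`. Keeping the last cube on
the left makes the induction close. -/
theorem sum_norm_driftMomentum_cube_le {E V : Type*} [NormedAddCommGroup V] [NormedSpace ℝ V]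
    [NormedAddCommGroup E] {h : E → V} {L β : ℝ} (hL : ∀ x y, ‖h x - h y‖ ≤ L * ‖x - y‖)
    (hβ0 : 0 < β) (hβ1 : β ≤ 1) (x : ℕ → E) (T : ℕ) :
    β * ∑ t ∈ Finset.range T, ‖driftMomentum h β x t‖ ^ 3 + ‖driftMomentum h β x T‖ ^ 3
      ≤ L ^ 3 / β ^ 2 * ∑ t ∈ Finset.range T, ‖x (t + 1) - x t‖ ^ 3 := by
  induction T with
  | zero => simp [driftMomentum]
  | succ T ih =>
    have h1 : ‖driftMomentum h β x (T + 1)‖ ≤ (1 - β) * ‖driftMomentum h β x T‖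
        + L * ‖x (T + 1) - x T‖ := by
      rw [driftMomentum]
      refine (norm_add_le _ _).trans (add_le_add ?_ ?_)
      · rw [norm_smul, Real.norm_of_nonneg (by linarith)]
      · rw [norm_sub_rev (x (T + 1))]
        exact hL _ _
    have h2 : 0 ≤ L * ‖x (T + 1) - x T‖ := (norm_nonneg _).trans (hL (x (T + 1)) (x T))
    have h3 := (pow_le_pow_left₀ (norm_nonneg _) h1 3).trans
      (add_cube_le_of_contraction hβ0 hβ1 (norm_nonneg _) h2)
    rw [Finset.sum_range_succ, Finset.sum_range_succ, mul_add, mul_add]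
    have e : (L * ‖x (T + 1) - x T‖) ^ 3 / β ^ 2 = L ^ 3 / β ^ 2 * ‖x (T + 1) - x T‖ ^ 3 := by
      ring
    linarith

variable {d b : ℕ} {S : Type*} [MeasurableSpace S] {D : Measure S}
  {F : S → EuclideanSpace ℝ (Fin d) → ℝ}

theorem hessMomentum_sub_eq (β : ℝ) (x : ℕ → EuclideanSpace ℝ (Fin d)) (z : Fin b → S)
    (s : ℕ → S) (t : ℕ) :
    hessMomentum F β x z s t - hess (objective D F) (x t)
      = (1 - β) ^ t • (batchHess F z (x 0) - hess (objective D F) (x 0))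
        + (1 - β) • driftMomentum (hess (objective D F)) β x t + noiseMomentum D F β x s t := by
  induction t with
  | zero =>
    simp only [hessMomentum, driftMomentum, noiseMomentum, pow_zero]
    module
  | succ t ih =>
    have h : hessMomentum F β x z s t = hess (objective D F) (x t)
        + ((1 - β) ^ t • (batchHess F z (x 0) - hess (objective D F) (x 0))
        + (1 - β) • driftMomentum (hess (objective D F)) β x t + noiseMomentum D F β x s t) := by
      rw [← ih]; abel
    rw [hessMomentum, h, driftMomentum, noiseMomentum, hessNoise]
    module

theorem norm_hessMomentum_sub_cube_le {β : ℝ} (hβ0 : 0 ≤ β) (hβ1 : β ≤ 1)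
    (x : ℕ → EuclideanSpace ℝ (Fin d)) (z : Fin b → S) (s : ℕ → S) (t : ℕ) :
    ‖hessMomentum F β x z s t - hess (objective D F) (x t)‖ ^ 3
      ≤ 9 * (1 - β) ^ t * ‖batchHess F z (x 0) - hess (objective D F) (x 0)‖ ^ 3
        + 9 * (1 - β) * ‖driftMomentum (hess (objective D F)) β x t‖ ^ 3
        + 9 / (1 + 2 * β) ^ 2 * ‖noiseMomentum D F β x s t‖ ^ 3 := by
  have hβ' : 0 ≤ 1 - β := by linarith
  -- For positive times one factor `1 - β` of the damped initial error is reserved for Jensen's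
  -- inequality; time `0` has none to spare and is trivial.
  rcases t with _ | t
  · have : 0 ≤ ‖batchHess F z (x 0) - hess (objective D F) (x 0)‖ ^ 3 := by positivity
    simp only [hessMomentum, driftMomentum, noiseMomentum, norm_zero]
    linarith
  · set B := ‖batchHess F z (x 0) - hess (objective D F) (x 0)‖ with hB
    have h1 : ‖hessMomentum F β x z s (t + 1) - hess (objective D F) (x (t + 1))‖
        ≤ (1 - β) * ((1 - β) ^ t * B)
          + (1 - β) * ‖driftMomentum (hess (objective D F)) β x (t + 1)‖
          + ‖noiseMomentum D F β x s (t + 1)‖ := by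
      rw [hessMomentum_sub_eq]
      refine norm_add₃_le.trans (le_of_eq ?_)
      rw [norm_smul, norm_smul, Real.norm_of_nonneg hβ', Real.norm_of_nonneg (by positivity)]
      ring
    have hB0 : 0 ≤ B := norm_nonneg _
    have h2 := (pow_le_pow_left₀ (norm_nonneg _) h1 3).trans (add_cube_le_of_momentum hβ0 hβ1
      (by positivity) (norm_nonneg _) (norm_nonneg _))
    refine h2.trans ?_
    have h3 : ((1 - β) ^ t) ^ 3 ≤ (1 - β) ^ t :=
      pow_le_of_le_one (by positivity) (pow_le_one₀ hβ' (by linarith)) (by norm_num)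
    have h4 : 9 * (1 - β) * ((1 - β) ^ t * B) ^ 3 ≤ 9 * (1 - β) ^ (t + 1) * B ^ 3 := by
      calc 9 * (1 - β) * ((1 - β) ^ t * B) ^ 3 = 9 * (1 - β) * ((1 - β) ^ t) ^ 3 * B ^ 3 := by ring
        _ ≤ 9 * (1 - β) * (1 - β) ^ t * B ^ 3 := by gcongr
        _ = _ := by ring
    linarith

end ErrorDecomposition

/-! ### Comparison of numerical constants -/

section NoiseConstant

theorem rpow_three_halves {y : ℝ} (hy : 0 ≤ y) : y ^ (3 / 2 : ℝ) = Real.sqrt y ^ 3 := by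
  rw [Real.rpow_div_two_eq_sqrt _ hy]
  exact_mod_cast Real.rpow_natCast (Real.sqrt y) 3

/-- The maximum is split into a variance part, matched with the `σ` term, and a range part, matched
with the `δ` term. The factor `1 + 2β` inside `q²` enters the cube with exponent `3/2`, which the
denominator `(1 + 2β)²` absorbs. -/
theorem noise_cube_le_hessVarianceConst {d : ℕ} {β σ δ : ℝ} (hβ : 0 ≤ β)
    (hσ : 0 ≤ σ) (hδ : 0 ≤ δ) {q : ℝ} (hq : 0 ≤ q)
    (hqv : 8 * Real.log d * q ^ 2 = (1 + 2 * β) * β * σ ^ 2) :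
    9 / (1 + 2 * β) ^ 2 * (240 * (Real.log d * max (β * δ) q) ^ 3)
      ≤ β ^ (3 / 2 : ℝ) * hessVarianceConst d β σ δ := by
  set l := Real.log d with hl
  have hl0 : 0 ≤ l := Real.log_natCast_nonneg d
  have he := Real.exp_one_gt_d9
  set e := Real.exp 1 with he'
  have he0 : 0 < e := Real.exp_pos 1
  have hw : 1 ≤ 1 + 2 * β := by linarith
  set p := Real.sqrt (e * (2 * l)) * Real.sqrt β * σ with hp
  have hp0 : 0 ≤ p := by positivity
  have hp2 : p ^ 2 = 2 * e * l * β * σ ^ 2 := by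
    rw [hp, mul_pow, mul_pow, Real.sq_sqrt (by positivity), Real.sq_sqrt hβ]
    ring
  have hvar : 240 * 9 * (l * q) ^ 3 ≤ (1 + 2 * β) ^ 2 * (8 * p ^ 3) := by
    -- The factor must satisfy `2 e * 0.1547² ≥ 1/8` for `h1` and `2160 * 0.1547³ ≤ 8` for `h4`; the
    -- admissible window is roughly from `0.1517` to `0.1547`.
    set m := 0.1547 * p with hm
    have hm0 : 0 ≤ m := by positivity
    have h1 : (l * q) ^ 2 ≤ (1 + 2 * β) * m ^ 2 := by
      have e1 : (l * q) ^ 2 = (1 + 2 * β) * (l * β * σ ^ 2) / 8 := by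
        have : (l * q) ^ 2 = l * (8 * l * q ^ 2) / 8 := by ring
        rw [this, hqv]
        ring
      have e2 : m ^ 2 = 0.1547 ^ 2 * (2 * e) * (l * β * σ ^ 2) := by
        rw [hm, mul_pow, hp2]
        ring
      rw [e1, e2]
      have h0 : 0 ≤ (1 + 2 * β) * (l * β * σ ^ 2) := by positivity
      nlinarith
    have h2 : l * q ≤ (1 + 2 * β) * m := by
      refine abs_le_of_sq_le_sq' (h1.trans ?_) (by positivity) |>.2
      rw [mul_pow (1 + 2 * β) m]
      have : (1 + 2 * β) ≤ (1 + 2 * β) ^ 2 := le_self_pow₀ hw (by norm_num)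
      exact mul_le_mul_of_nonneg_right this (sq_nonneg m)
    have h3 : (l * q) ^ 3 ≤ (1 + 2 * β) ^ 2 * m ^ 3 := by
      calc (l * q) ^ 3 = (l * q) ^ 2 * (l * q) := by ring
        _ ≤ ((1 + 2 * β) * m ^ 2) * ((1 + 2 * β) * m) := by gcongr
        _ = _ := by ring
    have h4 : 240 * 9 * m ^ 3 ≤ 8 * p ^ 3 := by
      rw [hm, mul_pow]
      have : 0 ≤ p ^ 3 := by positivity
      nlinarith
    calc 240 * 9 * (l * q) ^ 3 ≤ 240 * 9 * ((1 + 2 * β) ^ 2 * m ^ 3) :=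
          mul_le_mul_of_nonneg_left h3 (by norm_num)
      _ = (1 + 2 * β) ^ 2 * (240 * 9 * m ^ 3) := by ring
      _ ≤ _ := mul_le_mul_of_nonneg_left h4 (by positivity)
  have hrng : 240 * 9 * (l * (β * δ)) ^ 3 ≤ (1 + 2 * β) ^ 2 * (128 * e ^ 3 * (l * (β * δ)) ^ 3) := by
    have h0 : 0 ≤ (l * (β * δ)) ^ 3 := by positivity
    have h1 : (20 : ℝ) ≤ e ^ 3 := by
      calc (20 : ℝ) ≤ 2.718 ^ 3 := by norm_num
        _ ≤ e ^ 3 := by gcongr; linarith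
    calc 240 * 9 * (l * (β * δ)) ^ 3 ≤ 1 * (128 * e ^ 3 * (l * (β * δ)) ^ 3) := by nlinarith
      _ ≤ _ := by
        exact mul_le_mul_of_nonneg_right (one_le_pow₀ hw) (by positivity)
  have hmax : (l * max (β * δ) q) ^ 3 ≤ (l * (β * δ)) ^ 3 + (l * q) ^ 3 := by
    have h1 : 0 ≤ (l * (β * δ)) ^ 3 := by positivity
    have h2 : 0 ≤ (l * q) ^ 3 := by positivity
    rcases max_cases (β * δ) q with ⟨h, _⟩ | ⟨h, _⟩ <;> rw [h] <;> linarith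
  have hR : β ^ (3 / 2 : ℝ) * hessVarianceConst d β σ δ
      = 8 * p ^ 3 + 128 * e ^ 3 * (l * (β * δ)) ^ 3 := by
    rw [hessVarianceConst, rpow_three_halves hβ, rpow_three_halves (by positivity), ← he', ← hl]
    have hs : (Real.sqrt β ^ 3) * (Real.sqrt β ^ 3) = β ^ 3 := by
      rw [← mul_pow, Real.mul_self_sqrt hβ]
    rw [hp]
    linear_combination 128 * e ^ 3 * l ^ 3 * δ ^ 3 * hs
  rw [hR, div_mul_eq_mul_div, div_le_iff₀ (by positivity)]
  linarith

end NoiseConstant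

/-! ### Integrating the three parts and assembling the bound -/

section Main

variable {Ω S : Type*} [mΩ : MeasurableSpace Ω] [MeasurableSpace S] {d b : ℕ}
  {P : Measure Ω} {D : Measure S} {F : S → EuclideanSpace ℝ (Fin d) → ℝ} {L σ δ β : ℝ}
  {ℱ : Filtration ℕ mΩ} {x₀ : EuclideanSpace ℝ (Fin d)}
  {x : ℕ → Ω → EuclideanSpace ℝ (Fin d)} {ζ : Fin b → Ω → S} {ξ : ℕ → Ω → S}

theorem IsSampledRun.measurable_batchHess (hrun : IsSampledRun P D ℱ x₀ x ζ ξ)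
    (hF : IsStochasticProblem D F L) (y : EuclideanSpace ℝ (Fin d)) :
    Measurable fun ω => batchHess F (fun j => ζ j ω) y := by
  have h : ∀ j, Measurable fun ω => hess (F (ζ j ω)) y := fun j =>
    (measurable_hess_param hF.measurable hF.sample_twiceDifferentiable).comp
      (f := fun ω => (y, ζ j ω))
      (measurable_const.prodMk ((hrun.batch_measurable j).mono (ℱ.le 1) le_rfl))
  exact (Finset.measurable_sum _ fun j _ => h j).const_smul (b : ℝ)⁻¹

theorem IsSampledRun.ae_norm_batchHess_sub_le (hb : 1 ≤ b)
    (hrun : IsSampledRun P D ℱ x₀ x ζ ξ) (hN : HessianNoise D F σ δ)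
    (y : EuclideanSpace ℝ (Fin d)) :
    ∀ᵐ ω ∂P, ‖batchHess F (fun j => ζ j ω) y - hess (objective D F) y‖ ≤ δ := by
  have h : ∀ᵐ ω ∂P, ∀ j, ‖hess (F (ζ j ω)) y - hess (objective D F) y‖ ≤ δ := by
    rw [ae_all_iff]
    intro j
    have h1 : ∀ᵐ s ∂(P.map (ζ j)), ‖hess (F s) y - hess (objective D F) y‖ ≤ δ := by
      rw [hrun.batch_law j]
      exact hN.bound y
    exact ae_of_ae_map ((hrun.batch_measurable j).mono (ℱ.le 1) le_rfl).aemeasurable h1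
  filter_upwards [h] with ω hω
  have hb' : (b : ℝ) ≠ 0 := by positivity
  have e : batchHess F (fun j => ζ j ω) y - hess (objective D F) y
      = (b : ℝ)⁻¹ • ∑ j, (hess (F (ζ j ω)) y - hess (objective D F) y) := by
    rw [Finset.sum_sub_distrib, smul_sub, batchHess, Finset.sum_const, Finset.card_univ,
      Fintype.card_fin, ← Nat.cast_smul_eq_nsmul ℝ, smul_smul, inv_mul_cancel₀ hb', one_smul]
  rw [e, norm_smul, norm_inv, Real.norm_natCast, inv_mul_le_iff₀ (by positivity)]
  refine (norm_sum_le _ _).trans ((Finset.sum_le_sum fun j _ => hω j).trans (le_of_eq ?_))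
  simp

/-- The batch error is almost surely at most `δ`, so its cube is integrable and the real integral in
the hypothesis agrees with the extended one. -/
theorem IsSampledRun.lintegral_batchHess_sub_cube_le [IsProbabilityMeasure P] (hb : 1 ≤ b)
    (hrun : IsSampledRun P D ℱ x₀ x ζ ξ)
    (hF : IsStochasticProblem D F L) (hN : HessianNoise D F σ δ)
    (y : EuclideanSpace ℝ (Fin d)) {c : ℝ}
    (h : ∫ ω, ‖batchHess F (fun j => ζ j ω) y - hess (objective D F) y‖ ^ 3 ∂P ≤ c) :
    ∫⁻ ω, ‖batchHess F (fun j => ζ j ω) y - hess (objective D F) y‖ₑ ^ 3 ∂P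
      ≤ ENNReal.ofReal c := by
  have hm : Measurable fun ω => batchHess F (fun j => ζ j ω) y - hess (objective D F) y :=
    (hrun.measurable_batchHess hF y).sub_const _
  have hi : Integrable (fun ω =>
      ‖batchHess F (fun j => ζ j ω) y - hess (objective D F) y‖ ^ 3) P := by
    refine Integrable.of_bound (hm.norm.pow_const 3).aestronglyMeasurable (δ ^ 3) ?_
    filter_upwards [hrun.ae_norm_batchHess_sub_le hb hN y] with ω hω
    rw [norm_pow, norm_norm]
    gcongr
  refine le_trans (le_of_eq ?_) (ENNReal.ofReal_le_ofReal h)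
  rw [ofReal_integral_eq_lintegral_ofReal hi (Filter.Eventually.of_forall fun ω => by positivity)]
  refine lintegral_congr fun ω => ?_
  rw [ENNReal.ofReal_pow (norm_nonneg _), ofReal_norm]

theorem IsSampledRun.measurable_driftMomentum (hrun : IsSampledRun P D ℱ x₀ x ζ ξ)
    (hF : IsStochasticProblem D F L) (t : ℕ) :
    Measurable fun ω => driftMomentum (hess (objective D F)) β (fun k => x k ω) t := by
  have hx : ∀ t, Measurable fun ω => hess (objective D F) (x t ω) := fun t =>
    hF.continuous_hess.measurable.comp ((hrun.iterate_measurable t).mono (ℱ.le t) le_rfl)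
  induction t with
  | zero => exact measurable_const
  | succ t ih => exact (ih.const_smul (1 - β)).add ((hx t).sub (hx (t + 1)))

theorem IsSampledRun.sum_lintegral_driftMomentum_cube_le (hrun : IsSampledRun P D ℱ x₀ x ζ ξ)
    (hF : IsStochasticProblem D F L) (hL : 0 ≤ L) (hβ0 : 0 < β) (hβ1 : β ≤ 1) (T : ℕ) :
    ∑ t ∈ Finset.range T, ∫⁻ ω,
        ‖driftMomentum (hess (objective D F)) β (fun k => x k ω) t‖ₑ ^ 3 ∂P
      ≤ ENNReal.ofReal (L ^ 3 / β ^ 3)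
        * ∑ t ∈ Finset.range T, ∫⁻ ω, ‖x (t + 1) ω - x t ω‖ₑ ^ 3 ∂P := by
  have hx : ∀ t, Measurable (x t) := fun t => (hrun.iterate_measurable t).mono (ℱ.le t) le_rfl
  rw [← lintegral_finsetSum _ fun t _ => (hrun.measurable_driftMomentum hF t).enorm.pow_const 3,
    ← lintegral_finsetSum (f := fun t ω => ‖x (t + 1) ω - x t ω‖ₑ ^ 3) _
      fun t _ => ((hx (t + 1)).sub (hx t)).enorm.pow_const 3,
    ← lintegral_const_mul' _ _ ENNReal.ofReal_ne_top]
  refine lintegral_mono fun ω => ?_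
  have h := sum_norm_driftMomentum_cube_le hF.hess_lipschitz hβ0 hβ1 (fun k => x k ω) T
  have h1 : ∑ t ∈ Finset.range T,
      ‖driftMomentum (hess (objective D F)) β (fun k => x k ω) t‖ ^ 3
        ≤ L ^ 3 / β ^ 3 * ∑ t ∈ Finset.range T, ‖x (t + 1) ω - x t ω‖ ^ 3 := by
    have h2 : 0 ≤ ‖driftMomentum (hess (objective D F)) β (fun k => x k ω) T‖ ^ 3 := by positivity
    have h3 := (le_div_iff₀' hβ0).2 ((le_add_of_nonneg_right h2).trans h)
    refine h3.trans (le_of_eq ?_)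
    field_simp
  have h4 := ENNReal.ofReal_le_ofReal h1
  rw [ENNReal.ofReal_mul (by positivity), ENNReal.ofReal_sum_of_nonneg fun _ _ => by positivity,
    ENNReal.ofReal_sum_of_nonneg fun _ _ => by positivity] at h4
  simpa only [ENNReal.ofReal_pow (norm_nonneg _), ofReal_norm] using h4

end Main

theorem mainTheorem4 {Ω S : Type*} [mΩ : MeasurableSpace Ω] [MeasurableSpace S]
    (P : Measure Ω) [IsProbabilityMeasure P] (D : Measure S) [IsProbabilityMeasure D]
    {d b : ℕ} (hd : 2 ≤ d) (hb : 1 ≤ b)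
    (F : S → EuclideanSpace ℝ (Fin d) → ℝ)
    (L σ δ σ₀ : ℝ) (hσ : 0 ≤ σ)
    (hF : IsStochasticProblem D F L) (hnoise : HessianNoise D F σ δ)
    (ℱ : Filtration ℕ mΩ) (x₀ : EuclideanSpace ℝ (Fin d))
    (x : ℕ → Ω → EuclideanSpace ℝ (Fin d)) (ζ : Fin b → Ω → S) (ξ : ℕ → Ω → S)
    (hrun : IsSampledRun P D ℱ x₀ x ζ ξ)
    (hinit : ∫ ω, ‖batchHess F (fun j => ζ j ω) x₀ - hess (objective D F) x₀‖ ^ 3 ∂P ≤ σ₀ ^ 3)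
    (β : ℝ) (hβ0 : 0 < β) (hβ1 : β ≤ 1) (T : ℕ) (hT : 1 ≤ T) :
    (T : ℝ≥0∞)⁻¹ * ∑ t ∈ Finset.range T,
        ∫⁻ ω, ‖hessMomentum F β (fun k => x k ω) (fun j => ζ j ω) (fun k => ξ k ω) t
          - hess (objective D F) (x t ω)‖ₑ ^ 3 ∂P
      ≤ ENNReal.ofReal (10 * σ₀ ^ 3 / (β * T) + β ^ (3 / 2 : ℝ) * hessVarianceConst d β σ δ)
        + ENNReal.ofReal (9 * (1 - β) * L ^ 3 / β ^ 3)
          * ((T : ℝ≥0∞)⁻¹ * ∑ t ∈ Finset.range T, ∫⁻ ω, ‖x (t + 1) ω - x t ω‖ₑ ^ 3 ∂P) := by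
  set l := Real.log d with hl
  have hd' : (2 : ℝ) ≤ d := by exact_mod_cast hd
  have hl0 : 0 < l := Real.log_pos (by linarith)
  have hδ := hnoise.nonneg
  have hβ1' : 0 ≤ 1 - β := by linarith
  have hL : 0 ≤ L := by
    have h0 := (norm_nonneg _).trans
      (hF.hess_lipschitz (EuclideanSpace.single (⟨0, by omega⟩ : Fin d) (1 : ℝ)) 0)
    simpa using h0
  have hσ₀ : 0 ≤ σ₀ ^ 3 := (integral_nonneg fun ω => by positivity).trans hinit
  have hT0 : (0 : ℝ) < T := by exact_mod_cast hT
  -- The exact fixed point of the variance recursion is `β σ² / (2 - β)`; this polynomial majorant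
  -- has the factor `1 + 2β` that Jensen's denominator cancels. The choice of `q` below then gives
  -- `v = 4 l q²`.
  set v := (1 + 2 * β) * β * σ ^ 2 / 2 with hv
  set q := Real.sqrt (v / (4 * l)) with hq
  have hv0 : 0 ≤ v := by positivity
  have hq2 : q ^ 2 = v / (4 * l) := Real.sq_sqrt (by positivity)
  have hvrec : (1 - β) ^ 2 * v + β ^ 2 * σ ^ 2 ≤ v := by
    have h1 : v - ((1 - β) ^ 2 * v + β ^ 2 * σ ^ 2) = β ^ 3 * σ ^ 2 * (3 - 2 * β) / 2 := by
      rw [hv]; ring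
    have h2 : 0 ≤ β ^ 3 * σ ^ 2 * (3 - 2 * β) / 2 := by
      have : 0 ≤ 3 - 2 * β := by linarith
      positivity
    linarith
  have hηv : v ≤ 4 * l * max (β * δ) q ^ 2 := by
    have h1 : q ^ 2 ≤ max (β * δ) q ^ 2 :=
      pow_le_pow_left₀ (Real.sqrt_nonneg _) (le_max_right _ _) 2
    have h2 : v = 4 * l * q ^ 2 := by rw [hq2]; field_simp
    calc v = 4 * l * q ^ 2 := h2
      _ ≤ _ := by gcongr
  set B := ∫⁻ ω, ‖batchHess F (fun j => ζ j ω) x₀ - hess (objective D F) x₀‖ₑ ^ 3 ∂P with hB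
  have hBle : B ≤ ENNReal.ofReal (σ₀ ^ 3) :=
    hrun.lintegral_batchHess_sub_cube_le hb hF hnoise x₀ hinit
  set W : ℕ → ℝ≥0∞ := fun t => ∫⁻ ω,
    ‖driftMomentum (hess (objective D F)) β (fun k => x k ω) t‖ₑ ^ 3 ∂P with hW
  set R := ∑ t ∈ Finset.range T, ∫⁻ ω, ‖x (t + 1) ω - x t ω‖ₑ ^ 3 ∂P with hR
  set V := β ^ (3 / 2 : ℝ) * hessVarianceConst d β σ δ with hV
  have hV0 : 9 / (1 + 2 * β) ^ 2 * (240 * (l * max (β * δ) q) ^ 3) ≤ V := by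
    refine noise_cube_le_hessVarianceConst hβ0.le hσ hδ (Real.sqrt_nonneg _) ?_
    rw [← hl, hq2, hv]
    field_simp
    ring
  have hVnn : 0 ≤ V := le_trans (by positivity) hV0
  have hstep : ∀ t ∈ Finset.range T,
      ∫⁻ ω, ‖hessMomentum F β (fun k => x k ω) (fun j => ζ j ω) (fun k => ξ k ω) t
          - hess (objective D F) (x t ω)‖ₑ ^ 3 ∂P
        ≤ ENNReal.ofReal (9 * (1 - β) ^ t) * B + ENNReal.ofReal (9 * (1 - β)) * W t
          + ENNReal.ofReal V := by
    intro t _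
    have hpt : ∀ ω, ‖hessMomentum F β (fun k => x k ω) (fun j => ζ j ω) (fun k => ξ k ω) t
          - hess (objective D F) (x t ω)‖ₑ ^ 3
        ≤ ENNReal.ofReal (9 * (1 - β) ^ t)
            * ‖batchHess F (fun j => ζ j ω) x₀ - hess (objective D F) x₀‖ₑ ^ 3
          + ENNReal.ofReal (9 * (1 - β))
            * ‖driftMomentum (hess (objective D F)) β (fun k => x k ω) t‖ₑ ^ 3
          + ENNReal.ofReal (9 / (1 + 2 * β) ^ 2)
            * ‖noiseMomentum D F β (fun k => x k ω) (fun k => ξ k ω) t‖ₑ ^ 3 := by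
      intro ω
      have h := ENNReal.ofReal_le_ofReal (norm_hessMomentum_sub_cube_le (F := F) (D := D) hβ0.le hβ1
        (fun k => x k ω) (fun j => ζ j ω) (fun k => ξ k ω) t)
      simp only [hrun.init ω] at h
      rw [ENNReal.ofReal_add (by positivity) (by positivity),
        ENNReal.ofReal_add (by positivity) (by positivity),
        ENNReal.ofReal_mul (p := 9 * (1 - β) ^ t) (by positivity),
        ENNReal.ofReal_mul (p := 9 * (1 - β)) (by positivity),
        ENNReal.ofReal_mul (p := 9 / (1 + 2 * β) ^ 2) (by positivity)] at h
      simpa only [ENNReal.ofReal_pow (norm_nonneg _), ofReal_norm] using h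
    have hBm : Measurable fun ω => ENNReal.ofReal (9 * (1 - β) ^ t)
        * ‖batchHess F (fun j => ζ j ω) x₀ - hess (objective D F) x₀‖ₑ ^ 3 :=
      (((hrun.measurable_batchHess hF x₀).sub_const _).enorm.pow_const 3).const_mul _
    have hWm : Measurable fun ω => ENNReal.ofReal (9 * (1 - β))
        * ‖driftMomentum (hess (objective D F)) β (fun k => x k ω) t‖ₑ ^ 3 :=
      ((hrun.measurable_driftMomentum hF t).enorm.pow_const 3).const_mul _
    have hBWm : Measurable fun ω => ENNReal.ofReal (9 * (1 - β) ^ t)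
        * ‖batchHess F (fun j => ζ j ω) x₀ - hess (objective D F) x₀‖ₑ ^ 3
        + ENNReal.ofReal (9 * (1 - β))
        * ‖driftMomentum (hess (objective D F)) β (fun k => x k ω) t‖ₑ ^ 3 := hBm.add hWm
    refine (lintegral_mono hpt).trans ?_
    rw [lintegral_add_left hBWm, lintegral_add_left hBm,
      lintegral_const_mul' _ _ ENNReal.ofReal_ne_top,
      lintegral_const_mul' _ _ ENNReal.ofReal_ne_top,
      lintegral_const_mul' _ _ ENNReal.ofReal_ne_top]
    gcongr
    calc ENNReal.ofReal (9 / (1 + 2 * β) ^ 2)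
          * ∫⁻ ω, ‖noiseMomentum D F β (fun k => x k ω) (fun k => ξ k ω) t‖ₑ ^ 3 ∂P
        ≤ ENNReal.ofReal (9 / (1 + 2 * β) ^ 2)
          * ENNReal.ofReal (240 * (l * max (β * δ) q) ^ 3) := by
          gcongr
          exact hrun.lintegral_noiseMomentum_cube_le hd hF hnoise hβ0.le hβ1 hv0 hvrec t
            (by positivity) (le_max_left _ _) hηv
      _ = ENNReal.ofReal (9 / (1 + 2 * β) ^ 2 * (240 * (l * max (β * δ) q) ^ 3)) :=
          (ENNReal.ofReal_mul (by positivity)).symm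
      _ ≤ ENNReal.ofReal V := ENNReal.ofReal_le_ofReal hV0
  -- The geometric series gives `9 / β`; the constant `10` leaves slack.
  have hgeom : ∑ t ∈ Finset.range T, ENNReal.ofReal (9 * (1 - β) ^ t)
      ≤ ENNReal.ofReal (10 / β) := by
    rw [← ENNReal.ofReal_sum_of_nonneg fun _ _ => by positivity]
    refine ENNReal.ofReal_le_ofReal ?_
    have h1 : β * ∑ t ∈ Finset.range T, (1 - β) ^ t ≤ 1 := by
      have h2 := mul_neg_geom_sum (1 - β) T
      have h3 : 0 ≤ (1 - β) ^ T := by positivity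
      rw [sub_sub_cancel] at h2
      linarith
    rw [← Finset.mul_sum, le_div_iff₀ hβ0]
    linarith
  have hTinv : (T : ℝ≥0∞)⁻¹ = ENNReal.ofReal ((T : ℝ)⁻¹) := by
    rw [ENNReal.ofReal_inv_of_pos hT0, ENNReal.ofReal_natCast]
  have hT1 : (T : ℝ≥0∞)⁻¹ * T = 1 :=
    ENNReal.inv_mul_cancel (by exact_mod_cast (by omega : T ≠ 0)) (ENNReal.natCast_ne_top T)
  calc (T : ℝ≥0∞)⁻¹ * ∑ t ∈ Finset.range T,
        ∫⁻ ω, ‖hessMomentum F β (fun k => x k ω) (fun j => ζ j ω) (fun k => ξ k ω) t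
          - hess (objective D F) (x t ω)‖ₑ ^ 3 ∂P
      ≤ (T : ℝ≥0∞)⁻¹ * ∑ t ∈ Finset.range T, (ENNReal.ofReal (9 * (1 - β) ^ t) * B
          + ENNReal.ofReal (9 * (1 - β)) * W t + ENNReal.ofReal V) := by
        gcongr with t ht
        exact hstep t ht
    _ = (T : ℝ≥0∞)⁻¹ * ((∑ t ∈ Finset.range T, ENNReal.ofReal (9 * (1 - β) ^ t)) * B
          + ENNReal.ofReal (9 * (1 - β)) * ∑ t ∈ Finset.range T, W t
          + T * ENNReal.ofReal V) := by
        rw [Finset.sum_add_distrib, Finset.sum_add_distrib, Finset.sum_mul, Finset.mul_sum,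
          Finset.sum_const, Finset.card_range, nsmul_eq_mul]
    _ ≤ (T : ℝ≥0∞)⁻¹ * (ENNReal.ofReal (10 / β) * ENNReal.ofReal (σ₀ ^ 3)
          + ENNReal.ofReal (9 * (1 - β)) * (ENNReal.ofReal (L ^ 3 / β ^ 3) * R)
          + T * ENNReal.ofReal V) := by
        gcongr
        exact hrun.sum_lintegral_driftMomentum_cube_le hF hL hβ0 hβ1 T
    _ = _ := by
        rw [mul_add, mul_add, ← mul_assoc _ (T : ℝ≥0∞), hT1, one_mul,
          ENNReal.ofReal_add (by positivity) hVnn]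
        have e1 : (T : ℝ≥0∞)⁻¹ * (ENNReal.ofReal (10 / β) * ENNReal.ofReal (σ₀ ^ 3))
            = ENNReal.ofReal (10 * σ₀ ^ 3 / (β * T)) := by
          rw [hTinv, ← ENNReal.ofReal_mul (by positivity), ← ENNReal.ofReal_mul (by positivity)]
          congr 1
          field_simp
        have e2 : ENNReal.ofReal (9 * (1 - β) * L ^ 3 / β ^ 3)
            = ENNReal.ofReal (9 * (1 - β)) * ENNReal.ofReal (L ^ 3 / β ^ 3) := by
          rw [← ENNReal.ofReal_mul (by positivity), mul_div_assoc]
        rw [e1, e2]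
        ring
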